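/- Let $M$ be an $N$-dimensional $C^\infty$ manifold with a $C^\infty$ pseudo-Riemannian metric $a_{ij}(x)$ of signature $(+,-,-,\dots)$, a $C^\infty$ 1-form $b=b_i(x)y^i$ with $a^{ij}b_ib_j=-c^2(x)$, $0<c(x)\le 1$, and a $C^\infty$ scalar $g=g(x)$. Put $r_{ij}=a_{ij}+b_ib_j$, $\gamma=r_{ij}y^iy^j$, $q=\sqrt{|\gamma|}$, $B=\gamma-gbq-b^2$. A tangent vector $y$ is called time-like ($\epsilon=1$) if $\gamma>0$ and $B>0$, and space-like ($\epsilon=-1$) if $\gamma<0$, in which case $-2<g(x)<2$ is required. Let $h=\sqrt{1+\epsilon g^2/4}$, $G=g/h$, $g_\pm=-\tfrac12 g\pm h$, and let $F^2=BJ^2$ with $$J=\Bigl(\frac{b-g_-q}{g_+q-b}\Bigr)^{-G/4}\quad(\epsilon=1),\qquad J=e^{-\frac12Gf}\quad(\epsilon=-1),$$ where $f=-\arctan\frac G2+\arctan\frac{q+gb/2}{hb}$ for $b<0$, $f=-\pi-\arctan\frac G2+\arctan\frac{q+gb/2}{hb}$ for $b>0$, and $f=-\arctan\frac G2-\frac\pi2$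 (the common limit) for $b=0$. Put $y_i=\tfrac12\,\partial F^2/\partial y^i$, $g_{ij}=\partial y_i/\partial y^j$, $(g^{ij})=(g_{ij})^{-1}$, let $\gamma^i{}_{nm}=\frac12g^{ij}\bigl(\frac{\partial g_{jn}}{\partial x^m}+\frac{\partial g_{jm}}{\partial x^n}-\frac{\partial g_{nm}}{\partial x^j}\bigr)$ be the Finslerian Christoffel symbols, and let $G^i=\gamma^i{}_{nm}y^ny^m$ be the spray coefficients. Let $a^i{}_{nm}$ be the Christoffel symbols of $a_{ij}$, $\nabla_ib_j=\partial_ib_j-b_ka^k{}_{ij}$, $b^i=a^{ij}b_j$, $v^i=y^i+b\,b^i$, $\nu=q-\epsilon(1-c^2)gb$, $f_{mn}=\nabla_mb_n-\nabla_nb_m$, $f_k=f_{kn}y^n$, $f^i=a^{ik}f_{kn}y^n$, $g_h=\partial g/\partial x^h$ and $(yg)=y^hg_h$. Then in every local chart of $M$, at every point $x$ and every $y$ that is time-like, or space-like with $\nu\ne0$: $F^2$ is $C^\infty$ near $(x,y)$, $\nu\neq 0$, the matrix $(g_{ij})$ is invertible, and $$G^i=-\epsilon\frac g\nu\bigl(y^jy^h\nabla_jb_h-gq\,b^jf_j\bigr)v^i+gq\,f^i+E^i+a^i{}_{nm}y^ny^m,$$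 where $f_{mn}=\partial b_n/\partial x^m-\partial b_m/\partial x^n$, $$E^i=g^{ih}\frac{\partial y_h}{\partial g}(yg)-\frac12\bar MF^2g_hg^{ih},$$ and $\bar M$ is defined by $\partial F^2/\partial g=\bar MF^2$ (the derivatives $\partial/\partial g$, with $a_{ij}$, $b_i$ and $y$ fixed, exist). In particular $E^i=0$ wherever $g_h=0$ for all $h$, so for constant $g$; and if $\nabla_jb_h=0$ and $g_h=0$ at $x$ (the Berwald case), then $G^i=a^i{}_{nm}y^ny^m$ there. -/

import Mathlib

open scoped Manifold ContDiff Matrix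

noncomputable section

namespace PseudoFinsleroid

variable {N : ℕ}

/-! ### The metric function in a single tangent space

In this part `g : ℝ` is the value of the charge, `A = (a_ij)` and `β = (b_i)` are the components of
the pseudo-Riemannian metric and of the 1-form at a point, and `y = (y^i)` is a tangent vector. -/

/-- `b = b_i y^i`. -/
def bForm (β y : Fin N → ℝ) : ℝ := ∑ i, β i * y i

/-- `γ = r_ij y^i y^j` with `r_ij = a_ij + b_i b_j`. -/
def gammaForm (A : Matrix (Fin N) (Fin N) ℝ) (β y : Fin N → ℝ) : ℝ :=
  ∑ i, ∑ j, (A i j + β i * β j) * y i * y j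

/-- `q = √|γ|`. -/
def qForm (A : Matrix (Fin N) (Fin N) ℝ) (β y : Fin N → ℝ) : ℝ :=
  Real.sqrt |gammaForm A β y|

/-- `B = γ - g b q - b²`. -/
def BForm (g : ℝ) (A : Matrix (Fin N) (Fin N) ℝ) (β y : Fin N → ℝ) : ℝ :=
  gammaForm A β y - g * bForm β y * qForm A β y - bForm β y ^ 2

/-- The time-like sector: `γ > 0` and `B > 0`. -/
def TimeLike (g : ℝ) (A : Matrix (Fin N) (Fin N) ℝ) (β y : Fin N → ℝ) : Prop :=
  0 < gammaForm A β y ∧ 0 < BForm g A β y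

/-- The space-like sector: `γ < 0`, the charge being restricted to `-2 < g < 2`
(these conditions give `B < 0`). -/
def SpaceLike (g : ℝ) (A : Matrix (Fin N) (Fin N) ℝ) (β y : Fin N → ℝ) : Prop :=
  gammaForm A β y < 0 ∧ -2 < g ∧ g < 2

/-- The indicator: `ε = 1` on time-like and `ε = -1` on space-like vectors. -/
def indicator (A : Matrix (Fin N) (Fin N) ℝ) (β y : Fin N → ℝ) : ℝ :=
  if 0 < gammaForm A β y then 1 else -1

/-- `J` in the time-like sector as a function of `g`, `b`, `q`:
`J = ((b - g₋ q) / (g₊ q - b)) ^ (-G / 4)` with `h = √(1 + g²/4)`, `G = g / h`, `g± = -g/2 ± h`. -/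
def JTime (g b q : ℝ) : ℝ :=
  let h := Real.sqrt (1 + g ^ 2 / 4)
  ((b - (-g / 2 - h) * q) / ((-g / 2 + h) * q - b)) ^ (-(g / h) / 4)

/-- The angle `f` of the space-like sector, where `h = √(1 - g²/4)`, `G = g / h`, `L = q + g b / 2`:
`f = -arctan (G/2) + arctan (L / (h b))` for `b < 0` and
`f = -π - arctan (G/2) + arctan (L / (h b))` for `b > 0`;
for `b = 0` it is the common limit `-arctan (G/2) - π/2` of both expressions. -/
def fSpace (g b q : ℝ) : ℝ :=
  let h := Real.sqrt (1 - g ^ 2 / 4)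
  if b < 0 then -Real.arctan (g / h / 2) + Real.arctan ((q + g / 2 * b) / (h * b))
  else if b = 0 then -Real.arctan (g / h / 2) - Real.pi / 2
  else -Real.pi - Real.arctan (g / h / 2) + Real.arctan ((q + g / 2 * b) / (h * b))

/-- `J` in the space-like sector: `J = exp (-G f / 2)`, `h = √(1 - g²/4)`, `G = g / h`. -/
def JSpace (g b q : ℝ) : ℝ :=
  Real.exp (-(g / Real.sqrt (1 - g ^ 2 / 4)) / 2 * fSpace g b q)

/-- The function `J` on the time-like and on the space-like sector. -/
def JForm (g : ℝ) (A : Matrix (Fin N) (Fin N) ℝ) (β y : Fin N → ℝ) : ℝ :=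
  if 0 < gammaForm A β y then JTime g (bForm β y) (qForm A β y)
  else JSpace g (bForm β y) (qForm A β y)

/-- The squared metric function `F² = B J²`. -/
def Fsq (g : ℝ) (A : Matrix (Fin N) (Fin N) ℝ) (β y : Fin N → ℝ) : ℝ :=
  BForm g A β y * JForm g A β y ^ 2

/-- The partial derivative `∂φ/∂z^i` at `z`. -/
def pd (i : Fin N) (φ : (Fin N → ℝ) → ℝ) (z : Fin N → ℝ) : ℝ :=
  fderiv ℝ φ z (Pi.single i 1)

/-- The covariant tangent vector `y_i = (1/2) ∂F²/∂y^i`. -/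
def yLow (g : ℝ) (A : Matrix (Fin N) (Fin N) ℝ) (β y : Fin N → ℝ) (i : Fin N) : ℝ :=
  1 / 2 * pd i (fun z => Fsq g A β z) y

/-- The Finslerian metric tensor `g_ij = ∂y_i/∂y^j = (1/2) ∂²F²/∂y^i∂y^j`. -/
def metricLow (g : ℝ) (A : Matrix (Fin N) (Fin N) ℝ) (β y : Fin N → ℝ) :
    Matrix (Fin N) (Fin N) ℝ :=
  Matrix.of fun i j => pd j (fun z => yLow g A β z i) y

/-- The reciprocal tensor `g^ij`. -/
def metricUp (g : ℝ) (A : Matrix (Fin N) (Fin N) ℝ) (β y : Fin N → ℝ) :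
    Matrix (Fin N) (Fin N) ℝ :=
  (metricLow g A β y)⁻¹

/-- The contravariant components `b^i = a^ij b_j`. -/
def bUp (A : Matrix (Fin N) (Fin N) ℝ) (β : Fin N → ℝ) (i : Fin N) : ℝ :=
  ∑ j, A⁻¹ i j * β j

/-- `v^i = y^i + b b^i`. -/
def vUp (A : Matrix (Fin N) (Fin N) ℝ) (β y : Fin N → ℝ) (i : Fin N) : ℝ :=
  y i + bForm β y * bUp A β i

/-- `ν = q - ε (1 - c²) g b`. -/
def nu (g c : ℝ) (A : Matrix (Fin N) (Fin N) ℝ) (β y : Fin N → ℝ) : ℝ :=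
  qForm A β y - indicator A β y * (1 - c ^ 2) * g * bForm β y

/-- The function `M̄` with `∂F²/∂g = M̄ F²`, where `∂/∂g` is taken with `a_ij`, `b_i`, `y` fixed. -/
def Mbar (g : ℝ) (A : Matrix (Fin N) (Fin N) ℝ) (β y : Fin N → ℝ) : ℝ :=
  deriv (fun s => Fsq s A β y) g / Fsq g A β y

/-! ### Fields in a coordinate chart -/

/-- The component functions `a_ij(x)`, `b_i(x)`, `c(x)`, `g(x)` in local coordinates. -/
structure LocalFields (N : ℕ) where
  a : (Fin N → ℝ) → Matrix (Fin N) (Fin N) ℝ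
  b : (Fin N → ℝ) → Fin N → ℝ
  c : (Fin N → ℝ) → ℝ
  g : (Fin N → ℝ) → ℝ

namespace LocalFields

variable (L : LocalFields N)

/-- `F²(x, y)`. -/
def Fsq (x y : Fin N → ℝ) : ℝ := PseudoFinsleroid.Fsq (L.g x) (L.a x) (L.b x) y

/-- `g_ij(x, y)`. -/
def metricLow (x y : Fin N → ℝ) : Matrix (Fin N) (Fin N) ℝ :=
  PseudoFinsleroid.metricLow (L.g x) (L.a x) (L.b x) y

/-- `g^ij(x, y)`. -/
def metricUp (x y : Fin N → ℝ) : Matrix (Fin N) (Fin N) ℝ :=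
  PseudoFinsleroid.metricUp (L.g x) (L.a x) (L.b x) y

/-- The Finslerian Christoffel symbols
`γ^i_nm = (1/2) g^ij (∂g_jn/∂x^m + ∂g_jm/∂x^n - ∂g_nm/∂x^j)`. -/
def finslerChristoffel (x y : Fin N → ℝ) (i n m : Fin N) : ℝ :=
  1 / 2 * ∑ j, L.metricUp x y i j *
    (pd m (fun z => L.metricLow z y j n) x + pd n (fun z => L.metricLow z y j m) x
      - pd j (fun z => L.metricLow z y n m) x)

/-- The spray coefficients `G^i = γ^i_nm y^n y^m`. -/
def spray (x y : Fin N → ℝ) (i : Fin N) : ℝ :=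
  ∑ n, ∑ m, L.finslerChristoffel x y i n m * y n * y m

/-- The Christoffel symbols of the associated pseudo-Riemannian metric,
`a^k_ij = (1/2) a^kn (∂_j a_ni + ∂_i a_nj - ∂_n a_ji)`. -/
def christoffel (x : Fin N → ℝ) (k i j : Fin N) : ℝ :=
  1 / 2 * ∑ n, (L.a x)⁻¹ k n *
    (pd j (fun z => L.a z n i) x + pd i (fun z => L.a z n j) x - pd n (fun z => L.a z j i) x)

/-- The covariant derivative `∇_i b_j = ∂_i b_j - b_k a^k_ij`. -/
def nablaB (x : Fin N → ℝ) (i j : Fin N) : ℝ :=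
  pd i (fun z => L.b z j) x - ∑ k, L.b x k * L.christoffel x k i j

/-- The curl `f_mn = ∇_m b_n - ∇_n b_m`. -/
def curl (x : Fin N → ℝ) (m n : Fin N) : ℝ := L.nablaB x m n - L.nablaB x n m

/-- `f_k = f_kn y^n`. -/
def fLow (x y : Fin N → ℝ) (k : Fin N) : ℝ := ∑ n, L.curl x k n * y n

/-- `f^i = f^i_n y^n` with `f^i_n = a^ik f_kn`. -/
def fUp (x y : Fin N → ℝ) (i : Fin N) : ℝ := ∑ n, (∑ k, (L.a x)⁻¹ i k * L.curl x k n) * y n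

/-- The gradient `g_h = ∂g/∂x^h` of the charge. -/
def gradG (x : Fin N → ℝ) (h : Fin N) : ℝ := pd h L.g x

/-- `E^i = g^ih (∂y_h/∂g) (yg) - (1/2) M̄ F² g_h g^ih`, where `(yg) = y^h g_h` and `∂/∂g` is taken
with `a_ij`, `b_i`, `y` fixed. -/
def ETerm (x y : Fin N → ℝ) (i : Fin N) : ℝ :=
  (∑ h, L.metricUp x y i h * deriv (fun s => yLow s (L.a x) (L.b x) y h) (L.g x)) *
      (∑ h, y h * L.gradG x h)
    - 1 / 2 * Mbar (L.g x) (L.a x) (L.b x) y * L.Fsq x y *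
      ∑ h, L.gradG x h * L.metricUp x y i h

/-- `ν(x, y)`. -/
def nu (x y : Fin N → ℝ) : ℝ := PseudoFinsleroid.nu (L.g x) (L.c x) (L.a x) (L.b x) y

/-- The pseudo-Riemannian spray `a^i_nm y^n y^m`. -/
def baseSpray (x y : Fin N → ℝ) (i : Fin N) : ℝ :=
  ∑ n, ∑ m, L.christoffel x i n m * y n * y m

end LocalFields

/-! ### The space on a manifold -/

/-- The coordinate vector `∂/∂x^i` of the chart `e` at the point with coordinates `x`. -/
def coordVec {M : Type*} [TopologicalSpace M] [ChartedSpace (Fin N → ℝ) M]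
    (e : OpenPartialHomeomorph M (Fin N → ℝ)) (x : Fin N → ℝ) (i : Fin N) :
    TangentSpace 𝓘(ℝ, Fin N → ℝ) (e.symm x) :=
  mfderiv 𝓘(ℝ, Fin N → ℝ) 𝓘(ℝ, Fin N → ℝ) e.symm x (Pi.single i 1 : Fin N → ℝ)

/-- The components of the given fields with respect to the chart `e`. -/
def localFields {M : Type*} [TopologicalSpace M] [ChartedSpace (Fin N → ℝ) M]
    (S : ∀ p : M, TangentSpace 𝓘(ℝ, Fin N → ℝ) p →ₗ[ℝ] TangentSpace 𝓘(ℝ, Fin N → ℝ) p →ₗ[ℝ] ℝ)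
    (b : ∀ p : M, TangentSpace 𝓘(ℝ, Fin N → ℝ) p →ₗ[ℝ] ℝ) (c g : M → ℝ)
    (e : OpenPartialHomeomorph M (Fin N → ℝ)) : LocalFields N where
  a x := Matrix.of fun i j => S (e.symm x) (coordVec e x i) (coordVec e x j)
  b x i := b (e.symm x) (coordVec e x i)
  c x := c (e.symm x)
  g x := g (e.symm x)

/-- The data that determine the pseudo-Finsleroid space on the `N`-dimensional manifold `M`:
a smooth pseudo-Riemannian metric `S` of signature `(+ - - …)`, a smooth 1-form `b`
with `a^ij b_i b_j = -c²`, `0 < c ≤ 1`, and a smooth scalar field `g`, the charge.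
The conditions are expressed in the charts of the smooth structure. -/
structure Space (N : ℕ) (M : Type*) [TopologicalSpace M] [ChartedSpace (Fin N → ℝ) M] where
  S : ∀ p : M, TangentSpace 𝓘(ℝ, Fin N → ℝ) p →ₗ[ℝ] TangentSpace 𝓘(ℝ, Fin N → ℝ) p →ₗ[ℝ] ℝ
  b : ∀ p : M, TangentSpace 𝓘(ℝ, Fin N → ℝ) p →ₗ[ℝ] ℝ
  c : M → ℝ
  g : M → ℝ
  symm : ∀ p u w, S p u w = S p w u
  smooth_S : ∀ e ∈ IsManifold.maximalAtlas 𝓘(ℝ, Fin N → ℝ) ∞ M, ∀ i j,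
    ContDiffOn ℝ ∞ (fun x => (localFields S b c g e).a x i j) e.target
  signature : ∀ e ∈ IsManifold.maximalAtlas 𝓘(ℝ, Fin N → ℝ) ∞ M, ∀ x ∈ e.target,
    ∃ P : Matrix (Fin N) (Fin N) ℝ, IsUnit P.det ∧
      Pᵀ * (localFields S b c g e).a x * P =
        Matrix.diagonal fun i : Fin N => if (i : ℕ) = 0 then (1 : ℝ) else -1
  smooth_b : ∀ e ∈ IsManifold.maximalAtlas 𝓘(ℝ, Fin N → ℝ) ∞ M, ∀ i,
    ContDiffOn ℝ ∞ (fun x => (localFields S b c g e).b x i) e.target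
  c_pos : ∀ p, 0 < c p
  c_le_one : ∀ p, c p ≤ 1
  length_b : ∀ e ∈ IsManifold.maximalAtlas 𝓘(ℝ, Fin N → ℝ) ∞ M, ∀ x ∈ e.target,
    ∑ i, ∑ j, ((localFields S b c g e).a x)⁻¹ i j *
      (localFields S b c g e).b x i * (localFields S b c g e).b x j =
        -(localFields S b c g e).c x ^ 2
  smooth_g : ∀ e ∈ IsManifold.maximalAtlas 𝓘(ℝ, Fin N → ℝ) ∞ M,
    ContDiffOn ℝ ∞ (localFields S b c g e).g e.target

/-- The components of the fields of a space with respect to the chart `e`. -/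
def Space.inChart {M : Type*} [TopologicalSpace M] [ChartedSpace (Fin N → ℝ) M]
    (D : Space N M) (e : OpenPartialHomeomorph M (Fin N → ℝ)) : LocalFields N :=
  localFields D.S D.b D.c D.g e

end PseudoFinsleroid

end

namespace PseudoFinsleroid

/-! ### The two sectors as functions of `g`, `b`, `q` -/

/-! Both sectors are instances of one calculus. With `ε = ±1` one has `γ = ε q²` and `B = ε q² - g b
q - b²`, and although `J` is a power in one sector and an exponential of an angle in the other, for
fixed `g` both satisfy `dJ/J = g/(2B) (b dq - q db)` (`hasDerivAt_JTime`, `hasDerivAt_JSpace`).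
Nothing else about the `b`, `q` dependence of `J` is needed to differentiate; its `g`-derivative is
never computed, since it only enters through `E^i`.

Put `K = J²`. In `d(BK)` the `dq` terms combine into `dγ` (`AtSector.hasDerivAt_Fsq`), which gives
`y_i = K (a_ij y^j - g q b_i)` and, by one more differentiation, an explicit `g_ij`. A kernel vector
of `g_ij`, contracted with `y^i` and `b^i`, satisfies a small linear system whose solvability is
governed by `ν`; hence `ν ≠ 0` gives invertibility (`AtSector.isUnit_det_metricExpl`). For time-like
`y`, `ν > 0` is automatic (`TimeLike.nu_pos`).

For the spray, `g_ij y^j = y_i` and `y^i y_i = F²` turn the contracted Christoffel symbols into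
`g_ij G^j = y^m ∂_m y_i - ½ ∂_i F²`, with `y` fixed under `∂/∂x` (`RegularAt.spray_eq`). Expanding
by the chain rule, the terms with `∂g` are exactly the lowered `E^i` (`RegularAt.ETerm_eq`). The
remaining terms agree with `g_ij` applied to the rest of the claimed formula, a rational identity in
finitely many scalars (`AtSector.metricExpl_mulVec_spray`). Multiplying by `g^ij` finishes the
proof.

All derivatives, in `y`, `x` or `g`, are specializations of one computation along a curve on which
charge, metric, 1-form and vector vary together. -/

/-- `B` as a function of `g`, `b`, `q`, the sector being selected by `ε`. -/
def sectorB (ε s b q : ℝ) : ℝ := ε * q ^ 2 - s * b * q - b ^ 2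

/-- `J` as a function of `g`, `b`, `q`, the sector being selected by `ε`. -/
noncomputable def sectorJ (ε s b q : ℝ) : ℝ := if 0 < ε then JTime s b q else JSpace s b q

/-- The domain of `(g, b, q)` in the sector selected by `ε`. -/
def InSector (ε s b q : ℝ) : Prop :=
  0 < q ∧ (ε = 1 ∧ 0 < sectorB 1 s b q ∨ ε = -1 ∧ -2 < s ∧ s < 2)

lemma time_roots_pos {s b q : ℝ} (hq : 0 < q) (hB : 0 < sectorB 1 s b q) :
    0 < b - (-s / 2 - Real.sqrt (1 + s ^ 2 / 4)) * q ∧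
      0 < (-s / 2 + Real.sqrt (1 + s ^ 2 / 4)) * q - b := by
  unfold sectorB at hB
  set h := Real.sqrt (1 + s ^ 2 / 4) with hh
  have h2 : h ^ 2 = 1 + s ^ 2 / 4 := Real.sq_sqrt (by positivity)
  have hp : 0 < h := Real.sqrt_pos.2 (by positivity)
  have hm : 0 < (b - (-s / 2 - h) * q) * ((-s / 2 + h) * q - b) := by
    have : (b - (-s / 2 - h) * q) * ((-s / 2 + h) * q - b)
      = 1 * q ^ 2 - s * b * q - b ^ 2 := by linear_combination q ^ 2 * h2
    rw [this]; exact hB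
  have hqh := mul_pos hp hq
  rcases pos_and_pos_or_neg_and_neg_of_mul_pos hm with h1 | h1
  · exact h1
  -- The two factors add up to `2 h q > 0`, so they cannot both be negative.
  · exfalso; linarith [h1.1, h1.2]

lemma contDiffAt_JTime {s b q : ℝ} (hq : 0 < q) (hB : 0 < sectorB 1 s b q) :
    ContDiffAt ℝ ∞ (fun t : ℝ × ℝ × ℝ => JTime t.1 t.2.1 t.2.2) (s, b, q) := by
  obtain ⟨hu, hw⟩ := time_roots_pos hq hB
  unfold JTime
  have hs : ContDiffAt ℝ ∞ (fun t : ℝ × ℝ × ℝ => Real.sqrt (1 + t.1 ^ 2 / 4)) (s, b, q) :=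
    ContDiffAt.sqrt (by fun_prop) (by dsimp only; positivity)
  have hp : Real.sqrt (1 + s ^ 2 / 4) ≠ 0 := (Real.sqrt_pos.2 (by positivity)).ne'
  refine ContDiffAt.rpow (ContDiffAt.div ?_ ?_ hw.ne') ?_ (div_pos hu hw).ne'
  · fun_prop
  · fun_prop
  · exact ((contDiffAt_fst.div hs hp).neg).div_const _

/-- Write `J = (u/w)^(-G/4)` with `u = b - g₋q`, `w = g₊q - b`. Then `B = u w` and `u'w - u w' = 2h
(q b' - b q')`, so the factor `h` cancels against `G = g/h`. -/
lemma hasDerivAt_JTime {s : ℝ} {b q : ℝ → ℝ} {b' q' t : ℝ} (hq : 0 < q t)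
    (hB : 0 < sectorB 1 s (b t) (q t)) (hb' : HasDerivAt b b' t) (hq' : HasDerivAt q q' t) :
    HasDerivAt (fun r => JTime s (b r) (q r))
      (JTime s (b t) (q t) * (s / (2 * sectorB 1 s (b t) (q t))) * (b t * q' - q t * b')) t := by
  obtain ⟨hu, hw⟩ := time_roots_pos hq hB
  unfold JTime
  dsimp only
  have h2 : Real.sqrt (1 + s ^ 2 / 4) ^ 2 = 1 + s ^ 2 / 4 := Real.sq_sqrt (by positivity)
  have hp : 0 < Real.sqrt (1 + s ^ 2 / 4) := Real.sqrt_pos.2 (by positivity)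
  generalize Real.sqrt (1 + s ^ 2 / 4) = h at *
  have hBeq : sectorB 1 s (b t) (q t)
      = (b t - (-s / 2 - h) * q t) * ((-s / 2 + h) * q t - b t) := by
    unfold sectorB; linear_combination -(q t) ^ 2 * h2
  have hd := ((hb'.sub (hq'.const_mul (-s / 2 - h))).div
    ((hq'.const_mul (-s / 2 + h)).sub hb') hw.ne').rpow_const (p := -(s / h) / 4)
    (Or.inl (div_pos hu hw).ne')
  refine hd.congr_deriv ?_
  simp only [Pi.div_apply, Pi.sub_apply]
  rw [Real.rpow_sub_one (div_pos hu hw).ne', hBeq]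
  generalize ((b t - (-s / 2 - h) * q t) / ((-s / 2 + h) * q t - b t)) ^ (-(s / h) / 4) = R
  have hu' := hu.ne'
  have hw' := hw.ne'
  have hh := hp.ne'
  generalize hue : b t - (-s / 2 - h) * q t = u at hu' ⊢
  generalize hwe : (-s / 2 + h) * q t - b t = w at hw' ⊢
  field_simp
  rw [← hue, ← hwe]
  ring

/-- The three branches of `f` are one branch of the argument of `z = (q + g b/2) + i h b`. This
single formula shows that `f` is smooth across `b = 0`, because `z` stays in the slit plane. -/
lemma fSpace_eq {s b q : ℝ} (hq : 0 < q) (h1 : -2 < s) (h2 : s < 2) :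
    fSpace s b q = -Real.arctan (s / Real.sqrt (1 - s ^ 2 / 4) / 2) - Real.pi / 2 -
      (Complex.log (((q + s / 2 * b : ℝ) : ℂ) +
        ((Real.sqrt (1 - s ^ 2 / 4) * b : ℝ) : ℂ) * Complex.I)).im := by
  have hp : 0 < Real.sqrt (1 - s ^ 2 / 4) := Real.sqrt_pos.2 (by nlinarith)
  unfold fSpace
  dsimp only
  generalize Real.sqrt (1 - s ^ 2 / 4) = h at *
  rw [Complex.log_im]
  set z : ℂ := ((q + s / 2 * b : ℝ) : ℂ) + ((h * b : ℝ) : ℂ) * Complex.I with hz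
  have hre : z.re = q + s / 2 * b := by simp [hz]
  have him : z.im = h * b := by simp [hz]
  have hc := Complex.norm_mul_cos_arg z
  have hs := Complex.norm_mul_sin_arg z
  rw [hre] at hc
  rw [him] at hs
  have key : b ≠ 0 → (q + s / 2 * b) / (h * b) = Real.cos z.arg / Real.sin z.arg := by
    intro hb
    have hn : ‖z‖ ≠ 0 := by
      intro h0
      rw [h0, zero_mul] at hs
      exact mul_ne_zero hp.ne' hb hs.symm
    rw [← hc, ← hs, mul_div_mul_left _ _ hn]
  split_ifs with hb hb0
  -- For `b < 0` the argument lies in `(-π, 0)`, so `-π/2 - arg z` is in the range of `arctan` and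
  -- has tangent `cot (arg z)`.
  · have : Real.arctan ((q + s / 2 * b) / (h * b)) = -(Real.pi / 2) - z.arg := by
      have hneg : z.arg < 0 := Complex.arg_neg_iff.2 (by rw [him]; nlinarith)
      have hgt := Complex.neg_pi_lt_arg z
      rw [key hb.ne, ← Real.arctan_tan (x := -(Real.pi / 2) - z.arg) (by linarith) (by linarith),
        Real.tan_eq_sin_div_cos]
      congr 1
      rw [show -(Real.pi / 2) - z.arg = -(z.arg + Real.pi / 2) by ring, Real.sin_neg,
        Real.cos_neg, Real.sin_add_pi_div_two, Real.cos_add_pi_div_two, neg_div_neg_eq]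
    rw [this]; ring
  · have : z.arg = 0 := by
      rw [Complex.arg_eq_zero_iff, hre, him, hb0]
      simpa using hq.le
    rw [this]; ring
  · have hbp : 0 < b := lt_of_le_of_ne (not_lt.1 hb) (Ne.symm hb0)
    -- For `b > 0` the argument lies in `(0, π)`; the shift is now `π/2`, and the extra `-π` in the
    -- definition of `f` compensates for the difference.
    have : Real.arctan ((q + s / 2 * b) / (h * b)) = Real.pi / 2 - z.arg := by
      have hnn : 0 ≤ z.arg := Complex.arg_nonneg_iff.2 (by rw [him]; positivity)
      have hlt : z.arg < Real.pi := by
        refine lt_of_le_of_ne (Complex.arg_le_pi z) fun h0 => ?_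
        rw [h0, Real.sin_pi, mul_zero] at hs
        exact (mul_pos hp hbp).ne hs
      have hpos : 0 < z.arg := by
        refine lt_of_le_of_ne hnn fun h0 => ?_
        rw [← h0, Real.sin_zero, mul_zero] at hs
        exact (mul_pos hp hbp).ne hs
      rw [key hb0, ← Real.arctan_tan (x := Real.pi / 2 - z.arg) (by linarith) (by linarith),
        Real.tan_eq_sin_div_cos, Real.sin_pi_div_two_sub, Real.cos_pi_div_two_sub]
    rw [this]; ring

lemma space_mem_slitPlane {s b q : ℝ} (hq : 0 < q) (h1 : -2 < s) (h2 : s < 2) :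
    ((q + s / 2 * b : ℝ) : ℂ) + ((Real.sqrt (1 - s ^ 2 / 4) * b : ℝ) : ℂ) * Complex.I
      ∈ Complex.slitPlane := by
  have hp : 0 < Real.sqrt (1 - s ^ 2 / 4) := Real.sqrt_pos.2 (by nlinarith)
  rw [Complex.mem_slitPlane_iff]
  by_cases hb : b = 0
  · left; simpa [hb] using hq
  · right; simpa using ⟨hp.ne', hb⟩

lemma contDiffAt_sqrt_one_sub {s : ℝ} (h1 : -2 < s) (h2 : s < 2) :
    ContDiffAt ℝ ∞ (fun r : ℝ => Real.sqrt (1 - r ^ 2 / 4)) s :=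
  ContDiffAt.sqrt (by fun_prop) (by nlinarith)

lemma contDiffAt_JSpace {s b q : ℝ} (hq : 0 < q) (h1 : -2 < s) (h2 : s < 2) :
    ContDiffAt ℝ ∞ (fun t : ℝ × ℝ × ℝ => JSpace t.1 t.2.1 t.2.2) (s, b, q) := by
  have hp : Real.sqrt (1 - s ^ 2 / 4) ≠ 0 := (Real.sqrt_pos.2 (by nlinarith)).ne'
  have hs : ContDiffAt ℝ ∞ (fun t : ℝ × ℝ × ℝ => Real.sqrt (1 - t.1 ^ 2 / 4)) (s, b, q) :=
    ContDiffAt.comp (s, b, q) (f := Prod.fst) (contDiffAt_sqrt_one_sub h1 h2) contDiffAt_fst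
  have hG : ContDiffAt ℝ ∞ (fun t : ℝ × ℝ × ℝ => t.1 / Real.sqrt (1 - t.1 ^ 2 / 4) / 2)
      (s, b, q) := (contDiffAt_fst.div hs hp).div_const _
  have hlog : ContDiffAt ℝ ∞ (fun t : ℝ × ℝ × ℝ =>
      (Complex.log (((t.2.2 + t.1 / 2 * t.2.1 : ℝ) : ℂ) +
        ((Real.sqrt (1 - t.1 ^ 2 / 4) * t.2.1 : ℝ) : ℂ) * Complex.I)).im) (s, b, q) := by
    refine ContDiffAt.comp (s, b, q) (g := Complex.im) Complex.imCLM.contDiff.contDiffAt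
      (ContDiffAt.comp (s, b, q) (g := Complex.log)
        ((Complex.contDiffAt_log (space_mem_slitPlane (b := b) hq h1 h2)).restrict_scalars ℝ) ?_)
    refine ContDiffAt.add ?_ (ContDiffAt.mul ?_ contDiffAt_const)
    · exact Complex.ofRealCLM.contDiff.contDiffAt.comp (s, b, q)
        (f := fun t : ℝ × ℝ × ℝ => t.2.2 + t.1 / 2 * t.2.1) (by fun_prop)
    · exact Complex.ofRealCLM.contDiff.contDiffAt.comp (s, b, q)
        (f := fun t : ℝ × ℝ × ℝ => Real.sqrt (1 - t.1 ^ 2 / 4) * t.2.1)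
        (hs.mul (by fun_prop))
  have hf : ContDiffAt ℝ ∞ (fun t : ℝ × ℝ × ℝ => fSpace t.1 t.2.1 t.2.2) (s, b, q) := by
    refine (((hG.arctan.neg).sub (contDiffAt_const (c := Real.pi / 2))).sub hlog).congr_of_eventuallyEq ?_
    have e1 : ∀ᶠ t : ℝ × ℝ × ℝ in nhds (s, b, q), 0 < t.2.2 :=
      (by fun_prop : ContinuousAt (fun t : ℝ × ℝ × ℝ => t.2.2) (s, b, q)).eventually_const_lt hq
    have e2 : ∀ᶠ t : ℝ × ℝ × ℝ in nhds (s, b, q), -2 < t.1 :=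
      (by fun_prop : ContinuousAt (fun t : ℝ × ℝ × ℝ => t.1) (s, b, q)).eventually_const_lt h1
    have e3 : ∀ᶠ t : ℝ × ℝ × ℝ in nhds (s, b, q), t.1 < 2 :=
      (by fun_prop : ContinuousAt (fun t : ℝ × ℝ × ℝ => t.1) (s, b, q)).eventually_lt_const h2
    filter_upwards [e1, e2, e3] with t t1 t2 t3
    exact fSpace_eq t1 t2 t3
  unfold JSpace
  exact (((contDiffAt_fst.div hs hp).neg.div_const 2).mul hf).exp

/-- Differentiating `Im log z` produces `|z|² = -B` in the denominator, which is why the result has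
the same shape as in the time-like sector. -/
lemma hasDerivAt_JSpace {s : ℝ} {b q : ℝ → ℝ} {b' q' t : ℝ} (hq : 0 < q t)
    (h1 : -2 < s) (h2 : s < 2) (hb' : HasDerivAt b b' t) (hq' : HasDerivAt q q' t) :
    HasDerivAt (fun r => JSpace s (b r) (q r))
      (JSpace s (b t) (q t) * (s / (2 * sectorB (-1) s (b t) (q t))) * (b t * q' - q t * b'))
      t := by
  have hsl := space_mem_slitPlane (b := b t) hq h1 h2
  have hf : HasDerivAt (fun r => fSpace s (b r) (q r))
      (- (Real.sqrt (1 - s ^ 2 / 4) * (b t * q' - q t * b')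
        / sectorB (-1) s (b t) (q t))) t := by
    have hz : HasDerivAt (fun r => ((q r + s / 2 * b r : ℝ) : ℂ) +
        ((Real.sqrt (1 - s ^ 2 / 4) * b r : ℝ) : ℂ) * Complex.I)
        (((q' + s / 2 * b' : ℝ) : ℂ) +
        ((Real.sqrt (1 - s ^ 2 / 4) * b' : ℝ) : ℂ) * Complex.I) t :=
      (hq'.add (hb'.const_mul _)).ofReal_comp.add ((hb'.const_mul _).ofReal_comp.mul_const _)
    have hl := (hz.clog_real hsl)
    have him := Complex.imCLM.hasFDerivAt.comp_hasDerivAt t hl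
    have := him.const_sub (-Real.arctan (s / Real.sqrt (1 - s ^ 2 / 4) / 2) - Real.pi / 2)
    refine (this.congr_of_eventuallyEq ?_).congr_deriv ?_
    · filter_upwards [hq'.continuousAt.eventually_const_lt hq] with r hr
      exact fSpace_eq hr h1 h2
    · have hsq : Real.sqrt (1 - s ^ 2 / 4) ^ 2 = 1 - s ^ 2 / 4 := Real.sq_sqrt (by nlinarith)
      generalize Real.sqrt (1 - s ^ 2 / 4) = h at *
      rw [Complex.imCLM_apply, Complex.div_im]
      simp only [Complex.normSq_apply, Complex.add_re, Complex.add_im, Complex.ofReal_re,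
        Complex.ofReal_im, Complex.mul_re, Complex.mul_im, Complex.I_re, Complex.I_im]
      have hN : (q t + s / 2 * b t) ^ 2 + (h * b t) ^ 2 = - sectorB (-1) s (b t) (q t) := by
        unfold sectorB; linear_combination (b t) ^ 2 * hsq
      simp only [mul_zero, mul_one, sub_zero, add_zero, zero_add]
      rw [← pow_two, ← pow_two, hN, ← sub_div, div_neg, neg_neg, neg_inj.symm, neg_neg, ← neg_div]
      congr 1
      ring
  have hp : 0 < Real.sqrt (1 - s ^ 2 / 4) := Real.sqrt_pos.2 (by nlinarith)
  unfold JSpace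
  refine ((hf.const_mul (-(s / Real.sqrt (1 - s ^ 2 / 4)) / 2)).exp).congr_deriv ?_
  rw [mul_assoc]
  congr 1
  generalize Real.sqrt (1 - s ^ 2 / 4) = h at *
  have hp' := hp.ne'
  field_simp

/-- `J²` as a function of `g`, `b`, `q`. -/
noncomputable def sectorK (ε s b q : ℝ) : ℝ := sectorJ ε s b q ^ 2

/-- In the space-like case complete the square: `-B = (b + g q/2)² + (1 - g²/4) q²`, where `|g| < 2`
is used. -/
lemma InSector.sectorB_ne_zero {ε s b q : ℝ} (h : InSector ε s b q) : sectorB ε s b q ≠ 0 := by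
  obtain ⟨hq, ⟨rfl, hB⟩ | ⟨rfl, h1, h2⟩⟩ := h
  · exact hB.ne'
  · have : 0 < 1 - s ^ 2 / 4 := by nlinarith
    have hpos : 0 < q ^ 2 * (1 - s ^ 2 / 4) := by positivity
    have : sectorB (-1) s b q < 0 := by
      unfold sectorB; nlinarith [sq_nonneg (b + s / 2 * q)]
    exact this.ne

lemma InSector.sectorK_pos {ε s b q : ℝ} (h : InSector ε s b q) : 0 < sectorK ε s b q := by
  unfold sectorK sectorJ
  obtain ⟨hq, ⟨rfl, hB⟩ | ⟨rfl, h1, h2⟩⟩ := h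
  · obtain ⟨hu, hw⟩ := time_roots_pos hq hB
    rw [if_pos one_pos]
    exact pow_pos (Real.rpow_pos_of_pos (div_pos hu hw) _) 2
  · rw [if_neg (by norm_num)]
    exact pow_pos (Real.exp_pos _) 2

lemma InSector.contDiffAt_sectorK {ε s b q : ℝ} (h : InSector ε s b q) :
    ContDiffAt ℝ ∞ (fun t : ℝ × ℝ × ℝ => sectorK ε t.1 t.2.1 t.2.2) (s, b, q) := by
  unfold sectorK sectorJ
  obtain ⟨hq, ⟨rfl, hB⟩ | ⟨rfl, h1, h2⟩⟩ := h
  · simp only [if_pos one_pos]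
    exact (contDiffAt_JTime hq hB).pow 2
  · simp only [if_neg (show ¬ (0 : ℝ) < -1 by norm_num)]
    exact (contDiffAt_JSpace hq h1 h2).pow 2

lemma InSector.hasDerivAt_sectorJ {ε s : ℝ} {b q : ℝ → ℝ} {b' q' t : ℝ}
    (h : InSector ε s (b t) (q t)) (hb : HasDerivAt b b' t) (hq : HasDerivAt q q' t) :
    HasDerivAt (fun r => sectorJ ε s (b r) (q r))
      (sectorJ ε s (b t) (q t) * (s / (2 * sectorB ε s (b t) (q t))) * (b t * q' - q t * b'))
      t := by
  unfold sectorJ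
  obtain ⟨hq0, ⟨rfl, hB⟩ | ⟨rfl, h1, h2⟩⟩ := h
  · simp only [if_pos one_pos]
    exact hasDerivAt_JTime hq0 hB hb hq
  · simp only [if_neg (show ¬ (0 : ℝ) < -1 by norm_num)]
    exact hasDerivAt_JSpace hq0 h1 h2 hb hq

/-- The partial derivative of `J²` with respect to `g`. -/
noncomputable def sectorKs (ε s b q : ℝ) : ℝ := deriv (fun r => sectorK ε r b q) s

/-- Joint smoothness in `(g, b, q)` allows splitting the total derivative into a pure `g` part, left
abstract, and a part at fixed `g`, known from the logarithmic derivative of `J`. -/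
lemma InSector.hasDerivAt_sectorK {ε : ℝ} {s b q : ℝ → ℝ} {s' b' q' t : ℝ}
    (h : InSector ε (s t) (b t) (q t)) (hs : HasDerivAt s s' t) (hb : HasDerivAt b b' t)
    (hq : HasDerivAt q q' t) :
    HasDerivAt (fun r => sectorK ε (s r) (b r) (q r))
      (sectorKs ε (s t) (b t) (q t) * s' +
        sectorK ε (s t) (b t) (q t) * (s t / sectorB ε (s t) (b t) (q t)) *
          (b t * q' - q t * b')) t := by
  have hd := ((h.contDiffAt_sectorK).differentiableAt (by simp)).hasFDerivAt
  set F := fderiv ℝ (fun t : ℝ × ℝ × ℝ => sectorK ε t.1 t.2.1 t.2.2) (s t, b t, q t)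
  have e1 : F (1, 0, 0) = sectorKs ε (s t) (b t) (q t) :=
    (hd.comp_hasDerivAt (s t) ((hasDerivAt_id (s t)).prodMk
      ((hasDerivAt_const (s t) (b t)).prodMk (hasDerivAt_const (s t) (q t))))).deriv.symm
  have e2 : F (0, b', q') = sectorK ε (s t) (b t) (q t) * (s t / sectorB ε (s t) (b t) (q t)) *
          (b t * q' - q t * b') := by
    refine (hd.comp_hasDerivAt t ((hasDerivAt_const t (s t)).prodMk
      (hb.prodMk hq))).unique ?_
    refine ((h.hasDerivAt_sectorJ hb hq).pow 2).congr_deriv ?_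
    have := h.sectorB_ne_zero
    unfold sectorK
    field_simp
    ring
  refine (hd.comp_hasDerivAt t (hs.prodMk (hb.prodMk hq))).congr_deriv ?_
  have : (s', b', q') = s' • ((1, 0, 0) : ℝ × ℝ × ℝ) + (0, b', q') := by simp
  rw [this, map_add, map_smul, e1, e2, smul_eq_mul, mul_comm s']

/-! ### Sector conditions for a tangent vector -/

variable {N : ℕ}

/-- `y` is time-like and `ε = 1`, or space-like and `ε = -1`. -/
def AtSector (ε s : ℝ) (A : Matrix (Fin N) (Fin N) ℝ) (β y : Fin N → ℝ) : Prop :=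
  ε = 1 ∧ TimeLike s A β y ∨ ε = -1 ∧ SpaceLike s A β y

lemma bForm_eq (β y : Fin N → ℝ) : bForm β y = β ⬝ᵥ y := rfl

lemma gammaForm_eq (A : Matrix (Fin N) (Fin N) ℝ) (β y : Fin N → ℝ) :
    gammaForm A β y = y ⬝ᵥ A *ᵥ y + bForm β y ^ 2 := by
  rw [pow_two, bForm, Finset.sum_mul_sum]
  simp only [gammaForm, dotProduct, Matrix.mulVec, Finset.mul_sum, ← Finset.sum_add_distrib]
  refine Finset.sum_congr rfl fun i _ => Finset.sum_congr rfl fun j _ => ?_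
  ring

namespace AtSector

variable {ε s : ℝ} {A : Matrix (Fin N) (Fin N) ℝ} {β y : Fin N → ℝ}

lemma mul_self (h : AtSector ε s A β y) : ε * ε = 1 := by
  rcases h with ⟨rfl, _⟩ | ⟨rfl, _⟩ <;> norm_num

lemma gammaForm_ne_zero (h : AtSector ε s A β y) : gammaForm A β y ≠ 0 := by
  rcases h with ⟨_, h⟩ | ⟨_, h⟩
  · exact h.1.ne'
  · exact h.1.ne

lemma qForm_pos (h : AtSector ε s A β y) : 0 < qForm A β y :=
  Real.sqrt_pos.2 (abs_pos.2 h.gammaForm_ne_zero)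

lemma abs_gammaForm (h : AtSector ε s A β y) : |gammaForm A β y| = ε * gammaForm A β y := by
  rcases h with ⟨rfl, h⟩ | ⟨rfl, h⟩
  · rw [abs_of_pos h.1, one_mul]
  · rw [abs_of_neg h.1, neg_one_mul]

lemma gammaForm_eq_sq (h : AtSector ε s A β y) : gammaForm A β y = ε * qForm A β y ^ 2 := by
  rw [qForm, Real.sq_sqrt (abs_nonneg _), h.abs_gammaForm, ← mul_assoc, h.mul_self, one_mul]

lemma BForm_eq (h : AtSector ε s A β y) :
    BForm s A β y = sectorB ε s (bForm β y) (qForm A β y) := by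
  rw [BForm, sectorB, h.gammaForm_eq_sq]

lemma inSector (h : AtSector ε s A β y) : InSector ε s (bForm β y) (qForm A β y) := by
  refine ⟨h.qForm_pos, ?_⟩
  have hB := h.BForm_eq
  rcases h with ⟨rfl, h⟩ | ⟨rfl, h⟩
  · exact Or.inl ⟨rfl, hB ▸ h.2⟩
  · exact Or.inr ⟨rfl, h.2⟩

lemma pos_iff (h : AtSector ε s A β y) : 0 < gammaForm A β y ↔ 0 < ε := by
  rcases h with ⟨rfl, h⟩ | ⟨rfl, h⟩
  · simp [h.1]
  · exact iff_of_false h.1.not_gt (by norm_num)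

lemma indicator_eq (h : AtSector ε s A β y) : indicator A β y = ε := by
  rcases h with ⟨rfl, h⟩ | ⟨rfl, h⟩
  · simp [indicator, h.1]
  · simp [indicator, h.1.le]

lemma Fsq_eq (h : AtSector ε s A β y) :
    Fsq s A β y = sectorB ε s (bForm β y) (qForm A β y) *
      sectorK ε s (bForm β y) (qForm A β y) := by
  rw [Fsq, h.BForm_eq, JForm, sectorK, sectorJ]
  simp only [h.pos_iff]

end AtSector

/-! ### Regularity along families of fields -/

section Regularity

variable {E : Type*} [NormedAddCommGroup E] [NormedSpace ℝ E]
  {s : E → ℝ} {A : E → Matrix (Fin N) (Fin N) ℝ} {β y : E → Fin N → ℝ} {z : E} {ε : ℝ}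

lemma contDiffAt_bForm (hβ : ∀ i, ContDiffAt ℝ ∞ (fun r => β r i) z)
    (hy : ∀ i, ContDiffAt ℝ ∞ (fun r => y r i) z) :
    ContDiffAt ℝ ∞ (fun r => bForm (β r) (y r)) z := by
  unfold bForm
  exact ContDiffAt.sum fun i _ => (hβ i).mul (hy i)

lemma contDiffAt_gammaForm (hA : ∀ i j, ContDiffAt ℝ ∞ (fun r => A r i j) z)
    (hβ : ∀ i, ContDiffAt ℝ ∞ (fun r => β r i) z)
    (hy : ∀ i, ContDiffAt ℝ ∞ (fun r => y r i) z) :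
    ContDiffAt ℝ ∞ (fun r => gammaForm (A r) (β r) (y r)) z := by
  unfold gammaForm
  exact ContDiffAt.sum fun i _ => ContDiffAt.sum fun j _ =>
    (((hA i j).add ((hβ i).mul (hβ j))).mul (hy i)).mul (hy j)

lemma contDiffAt_qForm (hA : ∀ i j, ContDiffAt ℝ ∞ (fun r => A r i j) z)
    (hβ : ∀ i, ContDiffAt ℝ ∞ (fun r => β r i) z)
    (hy : ∀ i, ContDiffAt ℝ ∞ (fun r => y r i) z)
    (h : gammaForm (A z) (β z) (y z) ≠ 0) :
    ContDiffAt ℝ ∞ (fun r => qForm (A r) (β r) (y r)) z :=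
  ((contDiffAt_gammaForm hA hβ hy).abs h).sqrt (abs_pos.2 h).ne'

lemma AtSector.eventually (hs : ContDiffAt ℝ ∞ s z)
    (hA : ∀ i j, ContDiffAt ℝ ∞ (fun r => A r i j) z)
    (hβ : ∀ i, ContDiffAt ℝ ∞ (fun r => β r i) z)
    (hy : ∀ i, ContDiffAt ℝ ∞ (fun r => y r i) z)
    (h : AtSector ε (s z) (A z) (β z) (y z)) :
    ∀ᶠ r in nhds z, AtSector ε (s r) (A r) (β r) (y r) := by
  have hγ := contDiffAt_gammaForm hA hβ hy
  have hB := (hγ.sub ((hs.mul (contDiffAt_bForm hβ hy)).mul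
    (contDiffAt_qForm hA hβ hy h.gammaForm_ne_zero))).sub ((contDiffAt_bForm hβ hy).pow 2)
  rcases h with ⟨rfl, h⟩ | ⟨rfl, h⟩
  · filter_upwards [hγ.continuousAt.eventually_const_lt h.1,
      hB.continuousAt.eventually_const_lt h.2] with r h1 h2
    exact Or.inl ⟨rfl, h1, h2⟩
  · filter_upwards [hγ.continuousAt.eventually_lt_const h.1,
      hs.continuousAt.eventually_const_lt h.2.1,
      hs.continuousAt.eventually_lt_const h.2.2] with r h1 h2 h3
    exact Or.inr ⟨rfl, h1, h2, h3⟩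

lemma AtSector.contDiffAt_sectorK (hs : ContDiffAt ℝ ∞ s z)
    (hA : ∀ i j, ContDiffAt ℝ ∞ (fun r => A r i j) z)
    (hβ : ∀ i, ContDiffAt ℝ ∞ (fun r => β r i) z)
    (hy : ∀ i, ContDiffAt ℝ ∞ (fun r => y r i) z)
    (h : AtSector ε (s z) (A z) (β z) (y z)) :
    ContDiffAt ℝ ∞
      (fun r => sectorK ε (s r) (bForm (β r) (y r)) (qForm (A r) (β r) (y r))) z :=
  ContDiffAt.comp z
    (f := fun r => (s r, bForm (β r) (y r), qForm (A r) (β r) (y r)))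
    (g := fun t : ℝ × ℝ × ℝ => sectorK ε t.1 t.2.1 t.2.2) h.inSector.contDiffAt_sectorK
    (hs.prodMk ((contDiffAt_bForm hβ hy).prodMk (contDiffAt_qForm hA hβ hy h.gammaForm_ne_zero)))

lemma AtSector.contDiffAt_sectorB (hs : ContDiffAt ℝ ∞ s z)
    (hA : ∀ i j, ContDiffAt ℝ ∞ (fun r => A r i j) z)
    (hβ : ∀ i, ContDiffAt ℝ ∞ (fun r => β r i) z)
    (hy : ∀ i, ContDiffAt ℝ ∞ (fun r => y r i) z)
    (h : AtSector ε (s z) (A z) (β z) (y z)) :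
    ContDiffAt ℝ ∞
      (fun r => sectorB ε (s r) (bForm (β r) (y r)) (qForm (A r) (β r) (y r))) z := by
  have hq := contDiffAt_qForm hA hβ hy h.gammaForm_ne_zero
  have hb := contDiffAt_bForm hβ hy
  exact ((contDiffAt_const.mul (hq.pow 2)).sub ((hs.mul hb).mul hq)).sub (hb.pow 2)

lemma AtSector.contDiffAt_Fsq (hs : ContDiffAt ℝ ∞ s z)
    (hA : ∀ i j, ContDiffAt ℝ ∞ (fun r => A r i j) z)
    (hβ : ∀ i, ContDiffAt ℝ ∞ (fun r => β r i) z)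
    (hy : ∀ i, ContDiffAt ℝ ∞ (fun r => y r i) z)
    (h : AtSector ε (s z) (A z) (β z) (y z)) :
    ContDiffAt ℝ ∞ (fun r => Fsq (s r) (A r) (β r) (y r)) z :=
  ((h.contDiffAt_sectorB hs hA hβ hy).mul (h.contDiffAt_sectorK hs hA hβ hy)).congr_of_eventuallyEq
    ((h.eventually hs hA hβ hy).mono fun _ hr => hr.Fsq_eq)

/-- The explicit form of `y_i`. -/
noncomputable def yExpl (ε s : ℝ) (A : Matrix (Fin N) (Fin N) ℝ) (β y : Fin N → ℝ) (i : Fin N) :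
    ℝ :=
  sectorK ε s (bForm β y) (qForm A β y) * ((A *ᵥ y) i - s * qForm A β y * β i)

/-- The derivative `∂q/∂y^j`. -/
noncomputable def qGrad (ε : ℝ) (A : Matrix (Fin N) (Fin N) ℝ) (β y : Fin N → ℝ) (j : Fin N) :
    ℝ :=
  ε * ((A *ᵥ y) j + bForm β y * β j) / qForm A β y

/-- The explicit form of `g_ij`. -/
noncomputable def metricExpl (ε s : ℝ) (A : Matrix (Fin N) (Fin N) ℝ) (β y : Fin N → ℝ) :
    Matrix (Fin N) (Fin N) ℝ :=
  Matrix.of fun i j => sectorK ε s (bForm β y) (qForm A β y) *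
    (s / sectorB ε s (bForm β y) (qForm A β y) *
        (bForm β y * qGrad ε A β y j - qForm A β y * β j) *
        ((A *ᵥ y) i - s * qForm A β y * β i) + A i j - s * β i * qGrad ε A β y j)

lemma contDiffAt_mulVec (hA : ∀ i j, ContDiffAt ℝ ∞ (fun r => A r i j) z)
    (hy : ∀ i, ContDiffAt ℝ ∞ (fun r => y r i) z) (i : Fin N) :
    ContDiffAt ℝ ∞ (fun r => (A r *ᵥ y r) i) z := by
  simp only [Matrix.mulVec, dotProduct]
  exact ContDiffAt.sum fun j _ => (hA i j).mul (hy j)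

lemma AtSector.contDiffAt_yExpl (hs : ContDiffAt ℝ ∞ s z)
    (hA : ∀ i j, ContDiffAt ℝ ∞ (fun r => A r i j) z)
    (hβ : ∀ i, ContDiffAt ℝ ∞ (fun r => β r i) z)
    (hy : ∀ i, ContDiffAt ℝ ∞ (fun r => y r i) z)
    (h : AtSector ε (s z) (A z) (β z) (y z)) (i : Fin N) :
    ContDiffAt ℝ ∞ (fun r => yExpl ε (s r) (A r) (β r) (y r) i) z :=
  (h.contDiffAt_sectorK hs hA hβ hy).mul ((contDiffAt_mulVec hA hy i).sub
    ((hs.mul (contDiffAt_qForm hA hβ hy h.gammaForm_ne_zero)).mul (hβ i)))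

lemma AtSector.contDiffAt_metricExpl (hs : ContDiffAt ℝ ∞ s z)
    (hA : ∀ i j, ContDiffAt ℝ ∞ (fun r => A r i j) z)
    (hβ : ∀ i, ContDiffAt ℝ ∞ (fun r => β r i) z)
    (hy : ∀ i, ContDiffAt ℝ ∞ (fun r => y r i) z)
    (h : AtSector ε (s z) (A z) (β z) (y z)) (i j : Fin N) :
    ContDiffAt ℝ ∞ (fun r => metricExpl ε (s r) (A r) (β r) (y r) i j) z := by
  have hq := contDiffAt_qForm hA hβ hy h.gammaForm_ne_zero
  have hb := contDiffAt_bForm hβ hy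
  have hg : ContDiffAt ℝ ∞ (fun r => qGrad ε (A r) (β r) (y r) j) z :=
    ContDiffAt.div (contDiffAt_const.mul ((contDiffAt_mulVec hA hy j).add (hb.mul (hβ j)))) hq
      h.qForm_pos.ne'
  exact (h.contDiffAt_sectorK hs hA hβ hy).mul ((((((hs.div (h.contDiffAt_sectorB hs hA hβ hy)
    h.inSector.sectorB_ne_zero).mul ((hb.mul hg).sub (hq.mul (hβ j)))).mul
      ((contDiffAt_mulVec hA hy i).sub ((hs.mul hq).mul (hβ i))))).add (hA i j)).sub
        ((hs.mul (hβ i)).mul hg))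

end Regularity

lemma dotProduct_mulVec_comm_of_symm {A : Matrix (Fin N) (Fin N) ℝ} (hA : ∀ i j, A i j = A j i)
    (u w : Fin N → ℝ) : u ⬝ᵥ A *ᵥ w = w ⬝ᵥ A *ᵥ u := by
  have hT : Aᵀ = A := Matrix.ext fun i j => hA j i
  rw [Matrix.dotProduct_mulVec, dotProduct_comm, ← Matrix.mulVec_transpose, hT]

/-! ### Derivatives along curves of fields -/

section Curves

variable {ε t : ℝ} {s : ℝ → ℝ} {A : ℝ → Matrix (Fin N) (Fin N) ℝ} {β y : ℝ → Fin N → ℝ}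
  {s' : ℝ} {A' : Matrix (Fin N) (Fin N) ℝ} {β' y' : Fin N → ℝ}

lemma hasDerivAt_dotProduct (hβ : ∀ i, HasDerivAt (fun r => β r i) (β' i) t)
    (hy : ∀ i, HasDerivAt (fun r => y r i) (y' i) t) :
    HasDerivAt (fun r => β r ⬝ᵥ y r) (β' ⬝ᵥ y t + β t ⬝ᵥ y') t := by
  simp only [dotProduct, ← Finset.sum_add_distrib]
  exact HasDerivAt.fun_sum fun i _ => (hβ i).mul (hy i)

lemma hasDerivAt_mulVec (hA : ∀ i j, HasDerivAt (fun r => A r i j) (A' i j) t)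
    (hy : ∀ i, HasDerivAt (fun r => y r i) (y' i) t) (i : Fin N) :
    HasDerivAt (fun r => (A r *ᵥ y r) i) ((A' *ᵥ y t + A t *ᵥ y') i) t :=
  hasDerivAt_dotProduct (fun j => hA i j) hy

lemma hasDerivAt_gammaForm (hA : ∀ i j, HasDerivAt (fun r => A r i j) (A' i j) t)
    (hβ : ∀ i, HasDerivAt (fun r => β r i) (β' i) t)
    (hy : ∀ i, HasDerivAt (fun r => y r i) (y' i) t) (hsymm : ∀ i j, A t i j = A t j i) :
    HasDerivAt (fun r => gammaForm (A r) (β r) (y r))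
      (y t ⬝ᵥ A' *ᵥ y t + 2 * (y t ⬝ᵥ A t *ᵥ y') +
        2 * (bForm (β t) (y t) * (β' ⬝ᵥ y t + β t ⬝ᵥ y'))) t := by
  simp only [gammaForm_eq]
  have h1 := hasDerivAt_dotProduct hy (hasDerivAt_mulVec hA hy)
  have h2 := (hasDerivAt_dotProduct hβ hy).pow 2
  refine (h1.add h2).congr_deriv ?_
  rw [dotProduct_add, dotProduct_mulVec_comm_of_symm hsymm y', bForm_eq]
  push_cast
  ring

/-- The derivative of `q` along a curve of fields. -/
noncomputable def qDot (ε : ℝ) (A : Matrix (Fin N) (Fin N) ℝ) (β y : Fin N → ℝ)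
    (A' : Matrix (Fin N) (Fin N) ℝ) (β' y' : Fin N → ℝ) : ℝ :=
  ε * (y ⬝ᵥ A' *ᵥ y + 2 * (y ⬝ᵥ A *ᵥ y') + 2 * (bForm β y * (β' ⬝ᵥ y + β ⬝ᵥ y'))) /
    (2 * qForm A β y)

lemma AtSector.hasDerivAt_qForm {s : ℝ} (h : AtSector ε s (A t) (β t) (y t))
    (hA : ∀ i j, HasDerivAt (fun r => A r i j) (A' i j) t)
    (hβ : ∀ i, HasDerivAt (fun r => β r i) (β' i) t)
    (hy : ∀ i, HasDerivAt (fun r => y r i) (y' i) t) (hsymm : ∀ i j, A t i j = A t j i) :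
    HasDerivAt (fun r => qForm (A r) (β r) (y r))
      (qDot ε (A t) (β t) (y t) A' β' y') t := by
  have hγ := hasDerivAt_gammaForm hA hβ hy hsymm
  unfold qDot
  rcases h with ⟨rfl, h⟩ | ⟨rfl, h⟩
  · have := (hγ.congr_of_eventuallyEq (f₁ := fun r => |gammaForm (A r) (β r) (y r)|)
      ((hγ.continuousAt.eventually_const_lt h.1).mono fun r hr => abs_of_pos hr)).sqrt
        (abs_pos.2 h.1.ne').ne'
    simpa only [one_mul, qForm] using this
  · have := (hγ.neg.congr_of_eventuallyEq (f₁ := fun r => |gammaForm (A r) (β r) (y r)|)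
      ((hγ.continuousAt.eventually_lt_const h.1).mono fun r hr => abs_of_neg hr)).sqrt
        (abs_pos.2 h.1.ne).ne'
    simpa only [neg_one_mul, qForm] using this

lemma AtSector.hasDerivAt_sectorK (h : AtSector ε (s t) (A t) (β t) (y t))
    (hs : HasDerivAt s s' t)
    (hA : ∀ i j, HasDerivAt (fun r => A r i j) (A' i j) t)
    (hβ : ∀ i, HasDerivAt (fun r => β r i) (β' i) t)
    (hy : ∀ i, HasDerivAt (fun r => y r i) (y' i) t) (hsymm : ∀ i j, A t i j = A t j i) :
    HasDerivAt (fun r => sectorK ε (s r) (bForm (β r) (y r)) (qForm (A r) (β r) (y r)))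
      (sectorKs ε (s t) (bForm (β t) (y t)) (qForm (A t) (β t) (y t)) * s' +
        sectorK ε (s t) (bForm (β t) (y t)) (qForm (A t) (β t) (y t)) *
          (s t / sectorB ε (s t) (bForm (β t) (y t)) (qForm (A t) (β t) (y t))) *
          (bForm (β t) (y t) * qDot ε (A t) (β t) (y t) A' β' y' -
            qForm (A t) (β t) (y t) * (β' ⬝ᵥ y t + β t ⬝ᵥ y'))) t :=
  h.inSector.hasDerivAt_sectorK hs (hasDerivAt_dotProduct hβ hy)
    (h.hasDerivAt_qForm hA hβ hy hsymm)

/-- The derivative of `y_i` along a curve of fields. -/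
noncomputable def yDot (ε s : ℝ) (A : Matrix (Fin N) (Fin N) ℝ) (β y : Fin N → ℝ)
    (s' : ℝ) (A' : Matrix (Fin N) (Fin N) ℝ) (β' y' : Fin N → ℝ) (i : Fin N) : ℝ :=
  (sectorKs ε s (bForm β y) (qForm A β y) * s' +
      sectorK ε s (bForm β y) (qForm A β y) * (s / sectorB ε s (bForm β y) (qForm A β y)) *
        (bForm β y * qDot ε A β y A' β' y' - qForm A β y * (β' ⬝ᵥ y + β ⬝ᵥ y'))) *
      ((A *ᵥ y) i - s * qForm A β y * β i) +
    sectorK ε s (bForm β y) (qForm A β y) *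
      ((A' *ᵥ y) i + (A *ᵥ y') i - s' * qForm A β y * β i - s * qDot ε A β y A' β' y' * β i -
        s * qForm A β y * β' i)

lemma AtSector.hasDerivAt_yExpl (h : AtSector ε (s t) (A t) (β t) (y t))
    (hs : HasDerivAt s s' t)
    (hA : ∀ i j, HasDerivAt (fun r => A r i j) (A' i j) t)
    (hβ : ∀ i, HasDerivAt (fun r => β r i) (β' i) t)
    (hy : ∀ i, HasDerivAt (fun r => y r i) (y' i) t) (hsymm : ∀ i j, A t i j = A t j i)
    (i : Fin N) :
    HasDerivAt (fun r => yExpl ε (s r) (A r) (β r) (y r) i)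
      (yDot ε (s t) (A t) (β t) (y t) s' A' β' y' i) t := by
  refine ((h.hasDerivAt_sectorK hs hA hβ hy hsymm).mul ((hasDerivAt_mulVec hA hy i).sub
    ((hs.mul (h.hasDerivAt_qForm hA hβ hy hsymm)).mul (hβ i)))).congr_deriv ?_
  simp only [yDot, Pi.add_apply, Pi.sub_apply, Pi.mul_apply]
  ring

/-- The partial derivative of `F²` with respect to `g`. -/
noncomputable def FsqS (ε s : ℝ) (A : Matrix (Fin N) (Fin N) ℝ) (β y : Fin N → ℝ) : ℝ :=
  sectorB ε s (bForm β y) (qForm A β y) * sectorKs ε s (bForm β y) (qForm A β y) -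
    bForm β y * qForm A β y * sectorK ε s (bForm β y) (qForm A β y)

/-- For fixed `g`, `d(BK) = K (dB + g (b dq - q db))`, and the `g b dq` terms cancel. What remains
is `K (2ε q dq - 2b db - 2g q db)`, where `2ε q dq = dγ` eliminates `dq` altogether. -/
lemma AtSector.hasDerivAt_Fsq (h : AtSector ε (s t) (A t) (β t) (y t))
    (hs : HasDerivAt s s' t)
    (hA : ∀ i j, HasDerivAt (fun r => A r i j) (A' i j) t)
    (hβ : ∀ i, HasDerivAt (fun r => β r i) (β' i) t)
    (hy : ∀ i, HasDerivAt (fun r => y r i) (y' i) t) (hsymm : ∀ i j, A t i j = A t j i) :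
    HasDerivAt (fun r => sectorB ε (s r) (bForm (β r) (y r)) (qForm (A r) (β r) (y r)) *
        sectorK ε (s r) (bForm (β r) (y r)) (qForm (A r) (β r) (y r)))
      (FsqS ε (s t) (A t) (β t) (y t) * s' +
        sectorK ε (s t) (bForm (β t) (y t)) (qForm (A t) (β t) (y t)) *
          (y t ⬝ᵥ A' *ᵥ y t + 2 * (y t ⬝ᵥ A t *ᵥ y') -
            2 * s t * qForm (A t) (β t) (y t) * (β' ⬝ᵥ y t + β t ⬝ᵥ y'))) t := by
  have hb := hasDerivAt_dotProduct hβ hy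
  have hq := h.hasDerivAt_qForm hA hβ hy hsymm
  have hB : HasDerivAt (fun r => sectorB ε (s r) (bForm (β r) (y r)) (qForm (A r) (β r) (y r)))
      _ t := (((hq.pow 2).const_mul ε).sub ((hs.mul hb).mul hq)).sub (hb.pow 2)
  refine (hB.mul (h.hasDerivAt_sectorK hs hA hβ hy hsymm)).congr_deriv ?_
  have hB0 := h.inSector.sectorB_ne_zero
  have hq0 := h.qForm_pos.ne'
  have hε := h.mul_self
  have hqd : ε * (2 * qForm (A t) (β t) (y t) * qDot ε (A t) (β t) (y t) A' β' y') =
      y t ⬝ᵥ A' *ᵥ y t + 2 * (y t ⬝ᵥ A t *ᵥ y') +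
        2 * (bForm (β t) (y t) * (β' ⬝ᵥ y t + β t ⬝ᵥ y')) := by
    rw [qDot, mul_div_cancel₀ _ (by positivity), ← mul_assoc, hε, one_mul]
  simp only [Pi.mul_apply, ← bForm_eq (β t) (y t), FsqS] at hqd ⊢
  generalize sectorK ε (s t) (bForm (β t) (y t)) (qForm (A t) (β t) (y t)) = K
  generalize sectorKs ε (s t) (bForm (β t) (y t)) (qForm (A t) (β t) (y t)) = Ks
  generalize hBe : sectorB ε (s t) (bForm (β t) (y t)) (qForm (A t) (β t) (y t)) = B at hB0 ⊢
  generalize qDot ε (A t) (β t) (y t) A' β' y' = q' at hqd ⊢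
  have : B * (K * (s t / B)) = K * s t := by field_simp
  push_cast
  linear_combination K * hqd +
    (bForm (β t) (y t) * q' - qForm (A t) (β t) (y t) * (β' ⬝ᵥ y t + β t ⬝ᵥ y')) * this

end Curves

/-! ### Partial derivatives -/

/-- Bridge from the curve computations to partial derivatives: differentiability is known from
smoothness, so restriction to a straight line identifies the value. -/
lemma fderiv_apply_eq_of_curve {φ : (Fin N → ℝ) → ℝ} {z w : Fin N → ℝ} {d : ℝ}
    (hφ : DifferentiableAt ℝ φ z) (h : HasDerivAt (fun r : ℝ => φ (z + r • w)) d 0) :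
    fderiv ℝ φ z w = d := by
  have hl : HasDerivAt (fun r : ℝ => z + r • w) w 0 := by
    simpa using ((hasDerivAt_id (0 : ℝ)).smul_const w).const_add z
  have hφ' : HasFDerivAt φ (fderiv ℝ φ z) (z + (0 : ℝ) • w) := by
    simpa using hφ.hasFDerivAt
  exact (hφ'.comp_hasDerivAt (0 : ℝ) hl).unique h

lemma hasDerivAt_line {φ : (Fin N → ℝ) → ℝ} {z : Fin N → ℝ} (w : Fin N → ℝ)
    (hφ : DifferentiableAt ℝ φ z) :
    HasDerivAt (fun r : ℝ => φ (z + r • w)) (fderiv ℝ φ z w) 0 := by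
  have hl : HasDerivAt (fun r : ℝ => z + r • w) w 0 := by
    simpa using ((hasDerivAt_id (0 : ℝ)).smul_const w).const_add z
  have hφ' : HasFDerivAt φ (fderiv ℝ φ z) (z + (0 : ℝ) • w) := by
    simpa using hφ.hasFDerivAt
  exact hφ'.comp_hasDerivAt (0 : ℝ) hl

lemma sum_mul_pd (φ : (Fin N → ℝ) → ℝ) (z w : Fin N → ℝ) :
    ∑ m, w m * pd m φ z = fderiv ℝ φ z w := by
  simp only [pd, ← smul_eq_mul, ← map_smul, ← map_sum]
  congr 1
  ext k
  simp [Pi.single_apply]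

/-! ### Explicit `y_i` and `g_ij` from derivatives in the fibre -/

section Fibre

variable {ε s : ℝ} {A : Matrix (Fin N) (Fin N) ℝ} {β y : Fin N → ℝ}

lemma contDiffAt_coord (i : Fin N) : ContDiffAt ℝ ∞ (fun z : Fin N → ℝ => z i) y := by fun_prop

lemma AtSector.eventually_fibre (h : AtSector ε s A β y) :
    ∀ᶠ z in nhds y, AtSector ε s A β z :=
  AtSector.eventually (s := fun _ => s) (A := fun _ => A) (β := fun _ => β) (y := fun z => z)
    contDiffAt_const (fun _ _ => contDiffAt_const) (fun _ => contDiffAt_const)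
    contDiffAt_coord h

lemma hasDerivAt_coord_line (w : Fin N → ℝ) (i : Fin N) :
    HasDerivAt (fun r : ℝ => (y + r • w) i) (w i) 0 := by
  simpa using ((hasDerivAt_id (0 : ℝ)).mul_const (w i)).const_add (y i)

lemma AtSector.yLow_eq (h : AtSector ε s A β y) (hsymm : ∀ i j, A i j = A j i) (i : Fin N) :
    yLow s A β y i = yExpl ε s A β y i := by
  have hcd : DifferentiableAt ℝ (fun z => Fsq s A β z) y :=
    (AtSector.contDiffAt_Fsq (s := fun _ => s) (A := fun _ => A) (β := fun _ => β)
      (y := fun z => z) contDiffAt_const (fun _ _ => contDiffAt_const)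
      (fun _ => contDiffAt_const) contDiffAt_coord h).differentiableAt (by simp)
  have hd := AtSector.hasDerivAt_Fsq (t := 0) (s := fun _ => s) (A := fun _ => A)
    (β := fun _ => β) (y := fun r => y + r • (Pi.single i 1 : Fin N → ℝ)) (s' := 0) (A' := 0)
    (β' := 0) (by simpa using h) (hasDerivAt_const _ _) (fun _ _ => hasDerivAt_const _ _)
    (fun _ => hasDerivAt_const _ _) (hasDerivAt_coord_line _) hsymm
  have hl : Filter.Tendsto (fun r : ℝ => y + r • (Pi.single i 1 : Fin N → ℝ)) (nhds 0) (nhds y) := by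
    have : Continuous (fun r : ℝ => y + r • (Pi.single i 1 : Fin N → ℝ)) := by fun_prop
    simpa using this.tendsto 0
  have := fderiv_apply_eq_of_curve hcd (hd.congr_of_eventuallyEq
    ((hl.eventually h.eventually_fibre).mono fun r hr => hr.Fsq_eq))
  rw [yLow, pd, this, yExpl]
  simp only [zero_smul, add_zero]
  rw [dotProduct_mulVec_comm_of_symm hsymm]
  simp only [Matrix.zero_mulVec, dotProduct_zero, zero_dotProduct, single_one_dotProduct,
    dotProduct_single_one]
  ring

lemma AtSector.qDot_single (h : AtSector ε s A β y) (hsymm : ∀ i j, A i j = A j i) (j : Fin N) :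
    qDot ε A β y 0 0 (Pi.single j 1) = qGrad ε A β y j := by
  have := h.qForm_pos.ne'
  rw [qDot, qGrad, dotProduct_mulVec_comm_of_symm hsymm]
  simp only [Matrix.zero_mulVec, dotProduct_zero, zero_dotProduct, single_one_dotProduct,
    dotProduct_single_one]
  field_simp
  ring

lemma AtSector.metricLow_eq (h : AtSector ε s A β y) (hsymm : ∀ i j, A i j = A j i) :
    metricLow s A β y = metricExpl ε s A β y := by
  ext i j
  have hev : (fun z => yLow s A β z i) =ᶠ[nhds y] fun z => yExpl ε s A β z i :=
    h.eventually_fibre.mono fun z hz => hz.yLow_eq hsymm i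
  have hcd : DifferentiableAt ℝ (fun z => yExpl ε s A β z i) y :=
    (AtSector.contDiffAt_yExpl (s := fun _ => s) (A := fun _ => A) (β := fun _ => β)
      (y := fun z => z) contDiffAt_const (fun _ _ => contDiffAt_const)
      (fun _ => contDiffAt_const) contDiffAt_coord h i).differentiableAt (by simp)
  have hd := AtSector.hasDerivAt_yExpl (t := 0) (s := fun _ => s) (A := fun _ => A)
    (β := fun _ => β) (y := fun r => y + r • (Pi.single j 1 : Fin N → ℝ)) (s' := 0) (A' := 0)
    (β' := 0) (by simpa using h) (hasDerivAt_const _ _) (fun _ _ => hasDerivAt_const _ _)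
    (fun _ => hasDerivAt_const _ _) (hasDerivAt_coord_line _) hsymm i
  have := fderiv_apply_eq_of_curve hcd hd
  rw [metricLow, Matrix.of_apply, pd, hev.fderiv_eq, this, metricExpl, Matrix.of_apply]
  simp only [zero_smul, add_zero]
  rw [yDot, h.qDot_single hsymm]
  simp only [Matrix.zero_mulVec, zero_dotProduct, dotProduct_single_one, Pi.zero_apply,
    Matrix.mulVec_single_one, Matrix.col_apply]
  ring

end Fibre

/-! ### Linear algebra of the explicit metric tensor -/

section Algebra

variable {ε s c : ℝ} {A : Matrix (Fin N) (Fin N) ℝ} {β y : Fin N → ℝ}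

/-- The derivative of `q` in the fibre direction `X`. -/
noncomputable def qDir (ε : ℝ) (A : Matrix (Fin N) (Fin N) ℝ) (β y X : Fin N → ℝ) : ℝ :=
  ε * (y ⬝ᵥ A *ᵥ X + bForm β y * (β ⬝ᵥ X)) / qForm A β y

lemma qGrad_dotProduct (hsymm : ∀ i j, A i j = A j i) (X : Fin N → ℝ) :
    ∑ j, qGrad ε A β y j * X j = qDir ε A β y X := by
  rw [qDir, dotProduct_mulVec_comm_of_symm hsymm, dotProduct_comm]
  simp only [qGrad, dotProduct, Finset.mul_sum, ← Finset.sum_add_distrib, Finset.sum_div]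
  refine Finset.sum_congr rfl fun j _ => ?_
  ring

lemma metricExpl_mulVec (hsymm : ∀ i j, A i j = A j i) (X : Fin N → ℝ) (i : Fin N) :
    (metricExpl ε s A β y *ᵥ X) i = sectorK ε s (bForm β y) (qForm A β y) *
      (s / sectorB ε s (bForm β y) (qForm A β y) *
        (bForm β y * qDir ε A β y X - qForm A β y * (β ⬝ᵥ X)) *
        ((A *ᵥ y) i - s * qForm A β y * β i) + (A *ᵥ X) i - s * β i * qDir ε A β y X) := by
  rw [← qGrad_dotProduct hsymm]
  simp only [Matrix.mulVec, dotProduct, metricExpl, Matrix.of_apply, Finset.mul_sum,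
    Finset.sum_mul, ← Finset.sum_add_distrib, ← Finset.sum_sub_distrib]
  refine Finset.sum_congr rfl fun j _ => ?_
  ring

lemma AtSector.quad_self (h : AtSector ε s A β y) :
    y ⬝ᵥ A *ᵥ y = ε * qForm A β y ^ 2 - bForm β y ^ 2 := by
  rw [← h.gammaForm_eq_sq, gammaForm_eq]; ring

lemma mulVec_bUp (hA : IsUnit A.det) : A *ᵥ bUp A β = β := by
  rw [show bUp A β = A⁻¹ *ᵥ β from rfl, Matrix.mulVec_mulVec, Matrix.mul_nonsing_inv _ hA,
    Matrix.one_mulVec]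

lemma AtSector.nu_eq (h : AtSector ε s A β y) :
    nu s c A β y = qForm A β y - ε * (1 - c ^ 2) * s * bForm β y := by
  rw [nu, h.indicator_eq]

/-- If `g b ≥ q`, then `B ≤ -b² ≤ 0`; so `g b < q`, and scaling by `1 - c² ∈ [0, 1]` keeps this
below `q`. -/
lemma TimeLike.nu_pos (h : TimeLike s A β y) (hc0 : 0 < c) (hc1 : c ≤ 1) :
    0 < nu s c A β y := by
  have h' : AtSector 1 s A β y := Or.inl ⟨rfl, h⟩
  have hq := h'.qForm_pos
  have hB := h.2
  rw [h'.BForm_eq, sectorB] at hB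
  rw [h'.nu_eq]
  have hc2 : 0 ≤ 1 - c ^ 2 := by nlinarith
  have hc3 : 1 - c ^ 2 ≤ 1 := by nlinarith
  rcases le_or_gt (s * bForm β y) 0 with hs | hs
  · nlinarith [mul_nonneg hc2 (neg_nonneg.2 hs)]
  · have : s * bForm β y < qForm A β y := by
      by_contra hcon
      nlinarith [mul_nonneg hq.le (sub_nonneg.2 (not_lt.1 hcon)), sq_nonneg (bForm β y)]
    nlinarith [mul_nonneg hs.le (sub_nonneg.2 hc3)]

lemma AtSector.isUnit_det_metricExpl (h : AtSector ε s A β y) (hsymm : ∀ i j, A i j = A j i)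
    (hA : IsUnit A.det) (hc : β ⬝ᵥ bUp A β = -c ^ 2) (hν : nu s c A β y ≠ 0) :
    IsUnit (metricExpl ε s A β y).det := by
  rw [isUnit_iff_ne_zero]
  intro hdet
  obtain ⟨X, hX, hMX⟩ := Matrix.exists_mulVec_eq_zero_iff.2 hdet
  apply hX
  have hB0 := h.inSector.sectorB_ne_zero
  have hq0 := h.qForm_pos.ne'
  have hε := h.mul_self
  have hyy := h.quad_self
  rw [h.nu_eq] at hν
  have hBdef : sectorB ε s (bForm β y) (qForm A β y) =
    ε * qForm A β y ^ 2 - s * bForm β y * qForm A β y - bForm β y ^ 2 := rfl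
  have hqd : qForm A β y * qDir ε A β y X = ε * (y ⬝ᵥ A *ᵥ X + bForm β y * (β ⬝ᵥ X)) := by
    rw [qDir, mul_div_cancel₀ _ hq0]
  -- `k` is the relative derivative of `K` in the direction `X`. It is named so that `B` occurs only
  -- through the polynomial relation `hkB`.
  obtain ⟨k, hk⟩ : ∃ k, k = s / sectorB ε s (bForm β y) (qForm A β y) *
        (bForm β y * qDir ε A β y X - qForm A β y * (β ⬝ᵥ X)) := ⟨_, rfl⟩
  have hkB : k * sectorB ε s (bForm β y) (qForm A β y) =
      s * (bForm β y * qDir ε A β y X - qForm A β y * (β ⬝ᵥ X)) := by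
    rw [hk]; field_simp
  have hvec : k • (A *ᵥ y - (s * qForm A β y) • β) + A *ᵥ X - (s * qDir ε A β y X) • β = 0 := by
    ext i
    have := congrFun hMX i
    rw [metricExpl_mulVec hsymm, Pi.zero_apply,
      mul_eq_zero_iff_left h.inSector.sectorK_pos.ne', ← hk] at this
    simp only [Pi.add_apply, Pi.sub_apply, Pi.smul_apply, smul_eq_mul, Pi.zero_apply]
    linear_combination this
  have hAb : ∀ w, bUp A β ⬝ᵥ A *ᵥ w = β ⬝ᵥ w := fun w => by
    rw [dotProduct_mulVec_comm_of_symm hsymm, mulVec_bUp hA, dotProduct_comm]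
  -- Contracting with `y^i` and `b^i` reduces the kernel equation to scalars, with unknowns `k`,
  -- `d`, `ρ` and `θ = b_i X^i`.
  have e1 := congrArg (fun w => y ⬝ᵥ w) hvec
  have e2 := congrArg (fun w => bUp A β ⬝ᵥ w) hvec
  simp only [dotProduct_add, dotProduct_sub, dotProduct_smul, smul_eq_mul, dotProduct_zero, hAb,
    hyy, dotProduct_comm y β, dotProduct_comm (bUp A β) β, hc, ← bForm_eq β y] at e1 e2
  generalize sectorB ε s (bForm β y) (qForm A β y) = B at *
  generalize bForm β y = b at *
  generalize qForm A β y = q at *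
  generalize hd : qDir ε A β y X = d at *
  generalize hr : y ⬝ᵥ A *ᵥ X = ρ at *
  generalize β ⬝ᵥ X = θ at *
  have hρ : ρ = s * q * θ := by
    linear_combination e1 - hkB + k * hBdef
  have hqk : q * k = -(s * θ * ε) := by
    refine mul_right_cancel₀ hB0 ?_
    rw [hρ] at hqd
    linear_combination q * hkB + s * b * hqd + s * θ * ε * hBdef + s * θ * q ^ 2 * hε
  -- Eliminating `k`, `d` and `ρ` leaves exactly `θ ν = 0`. With `θ = 0` the other scalars vanish,
  -- and the kernel equation becomes `A X = 0`.
  have hθ : θ = 0 := by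
    have : θ * (q - ε * (1 - c ^ 2) * s * b) = 0 := by
      rw [hρ] at hqd
      linear_combination q * e2 - (b + s * q * c ^ 2) * hqk - s * c ^ 2 * hqd
    exact (mul_eq_zero.1 this).resolve_right hν
  have hk0 : k = 0 := by
    have : q * k = 0 := by rw [hqk, hθ]; ring
    exact (mul_eq_zero.1 this).resolve_left hq0
  have hd0 : d = 0 := by
    have : q * d = 0 := by rw [hqd, hρ, hθ]; ring
    exact (mul_eq_zero.1 this).resolve_left hq0
  have hAX : A *ᵥ X = 0 := by
    simpa [hk0, hd0] using hvec
  have : A⁻¹ *ᵥ (A *ᵥ X) = X := by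
    rw [Matrix.mulVec_mulVec, Matrix.nonsing_inv_mul _ hA, Matrix.one_mulVec]
  rw [← this, hAX, Matrix.mulVec_zero]

/-- The algebraic core: lowering the index of the non-`E` part of the spray coefficients.
Here `D_i = y^j y^m ∂_m a_ij`, `P_i = y^k y^l ∂_i a_kl`, `Dβ_i = y^m ∂_m b_i` and
`Q_i = y^k ∂_i b_k`. -/
lemma AtSector.metricExpl_mulVec_spray (h : AtSector ε s A β y) (hsymm : ∀ i j, A i j = A j i)
    (hA : IsUnit A.det) (hc : β ⬝ᵥ bUp A β = -c ^ 2) (hν : nu s c A β y ≠ 0)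
    {D P Dβ Q base f : Fin N → ℝ} (hbase : A *ᵥ base = D - (1 / 2 : ℝ) • P)
    (hf : A *ᵥ f = Q - Dβ) (hDP : y ⬝ᵥ P = y ⬝ᵥ D) (hQ : y ⬝ᵥ Q = y ⬝ᵥ Dβ) {S φ : ℝ}
    (hS : S = y ⬝ᵥ Dβ - β ⬝ᵥ base) (hφ : φ = β ⬝ᵥ f) (i : Fin N) :
    (metricExpl ε s A β y *ᵥ
      ((-ε * (s / nu s c A β y) * (S - s * qForm A β y * φ)) • vUp A β y +
        (s * qForm A β y) • f + base)) i =
      sectorK ε s (bForm β y) (qForm A β y) *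
        (s / sectorB ε s (bForm β y) (qForm A β y) *
          (bForm β y * (ε * (y ⬝ᵥ D + 2 * (bForm β y * (y ⬝ᵥ Dβ))) / (2 * qForm A β y)) -
            qForm A β y * (y ⬝ᵥ Dβ)) * ((A *ᵥ y) i - s * qForm A β y * β i) +
          (D i - s * (ε * (y ⬝ᵥ D + 2 * (bForm β y * (y ⬝ᵥ Dβ))) / (2 * qForm A β y)) * β i -
            s * qForm A β y * Dβ i) - 1 / 2 * (P i - 2 * s * qForm A β y * Q i)) := by
  have hB0 := h.inSector.sectorB_ne_zero
  have hq0 := h.qForm_pos.ne'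
  have hyy := h.quad_self
  have hBdef : sectorB ε s (bForm β y) (qForm A β y) =
    ε * qForm A β y ^ 2 - s * bForm β y * qForm A β y - bForm β y ^ 2 := rfl
  have hνeq := h.nu_eq (c := c)
  have hε : ε = 1 ∨ ε = -1 := by
    rcases h with h | h
    · exact Or.inl h.1
    · exact Or.inr h.1
  -- Taking the quotient `σ` as the variable and solving for `S` removes `ν` from all denominators.
  obtain ⟨σ, hσ⟩ : ∃ σ, σ = (S - s * qForm A β y * φ) / nu s c A β y := ⟨_, rfl⟩
  have hc1 : -ε * (s / nu s c A β y) * (S - s * qForm A β y * φ) = -ε * s * σ := by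
    rw [hσ]; ring
  have hSσ : S = σ * nu s c A β y + s * qForm A β y * φ := by
    rw [hσ]; field_simp; ring
  have hv : vUp A β y = y + bForm β y • bUp A β := rfl
  have hyf : y ⬝ᵥ A *ᵥ f = 0 := by rw [hf, dotProduct_sub, hQ, sub_self]
  have hyb : y ⬝ᵥ A *ᵥ base = 1 / 2 * (y ⬝ᵥ D) := by
    rw [hbase, dotProduct_sub, dotProduct_smul, hDP, smul_eq_mul]; ring
  have hDβ : y ⬝ᵥ Dβ = S + β ⬝ᵥ base := by rw [hS]; ring
  have hfi : (A *ᵥ f) i = Q i - Dβ i := congrFun hf i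
  have hbi : (A *ᵥ base) i = D i - 1 / 2 * P i := congrFun hbase i
  rw [metricExpl_mulVec hsymm, qDir, hc1, hv]
  simp only [Matrix.mulVec_add, Matrix.mulVec_smul, mulVec_bUp hA, dotProduct_add,
    dotProduct_smul, smul_eq_mul, hyf, hyb, hyy, hc, ← hφ, hfi, hbi, Pi.add_apply, Pi.smul_apply,
    dotProduct_comm y β, ← bForm_eq β y, hDβ]
  rw [hSσ, hνeq]
  congr 1
  generalize sectorB ε s (bForm β y) (qForm A β y) = B at *
  generalize bForm β y = b at *
  generalize qForm A β y = q at *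
  have key : ∀ U : ℝ, (s / B) * U * ((A *ᵥ y) i - s * q * β i) =
      U * (s * ((A *ᵥ y) i - s * q * β i) / B) := fun U => by ring
  rw [key, key]
  -- After absorbing `1/B` into `Z`, this relation is all that is needed about `B`; the final
  -- identity is a multiple of it.
  have hZ : s * ((A *ᵥ y) i - s * q * β i) / B * (ε * q ^ 2 - s * b * q - b ^ 2) =
      s * ((A *ᵥ y) i - s * q * β i) := by
    rw [← hBdef, div_mul_cancel₀ _ hB0]
  generalize s * ((A *ᵥ y) i - s * q * β i) / B = Z at hZ ⊢
  rcases hε with rfl | rfl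
  · field_simp
    linear_combination 2 * q * σ * hZ
  · field_simp
    linear_combination -2 * q * σ * hZ

end Algebra

/-! ### Homogeneity relations and derivatives in the charge -/

section Fibre

variable {ε s : ℝ} {A : Matrix (Fin N) (Fin N) ℝ} {β y : Fin N → ℝ}

/-- `q` is homogeneous of degree one in `y`, so its derivative in the direction `y` is `q`, and `b
dq - q db` vanishes there: `K` is homogeneous of degree zero. -/
lemma AtSector.metricExpl_mulVec_self (h : AtSector ε s A β y) (hsymm : ∀ i j, A i j = A j i)
    (i : Fin N) : (metricExpl ε s A β y *ᵥ y) i = yExpl ε s A β y i := by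
  have hq0 := h.qForm_pos.ne'
  have hd : qDir ε A β y y = qForm A β y := by
    rw [qDir, h.quad_self, ← bForm_eq, div_eq_iff hq0]
    linear_combination qForm A β y ^ 2 * h.mul_self
  rw [metricExpl_mulVec hsymm, hd, yExpl, ← bForm_eq]
  ring

lemma AtSector.dotProduct_yExpl (h : AtSector ε s A β y) :
    y ⬝ᵥ yExpl ε s A β y =
      sectorB ε s (bForm β y) (qForm A β y) * sectorK ε s (bForm β y) (qForm A β y) := by
  have : yExpl ε s A β y = sectorK ε s (bForm β y) (qForm A β y) •
      (A *ᵥ y - (s * qForm A β y) • β) := rfl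
  rw [this, dotProduct_smul, dotProduct_sub, dotProduct_smul, h.quad_self, dotProduct_comm y β,
    ← bForm_eq, sectorB, smul_eq_mul, smul_eq_mul]
  ring

lemma AtSector.eventually_charge (h : AtSector ε s A β y) :
    ∀ᶠ r in nhds s, AtSector ε r A β y :=
  AtSector.eventually (s := fun r => r) (A := fun _ => A) (β := fun _ => β) (y := fun _ => y)
    contDiffAt_id (fun _ _ => contDiffAt_const) (fun _ => contDiffAt_const)
    (fun _ => contDiffAt_const) h

lemma AtSector.hasDerivAt_yLow_charge (h : AtSector ε s A β y) (hsymm : ∀ i j, A i j = A j i)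
    (i : Fin N) :
    HasDerivAt (fun r => yLow r A β y i) (yDot ε s A β y 1 0 0 0 i) s :=
  (AtSector.hasDerivAt_yExpl (s := fun r => r) (A := fun _ => A) (β := fun _ => β)
    (y := fun _ => y) (A' := 0) (β' := 0) (y' := 0) h (hasDerivAt_id s)
    (fun _ _ => hasDerivAt_const _ _) (fun _ => hasDerivAt_const _ _)
    (fun _ => hasDerivAt_const _ _) hsymm i).congr_of_eventuallyEq
    (h.eventually_charge.mono fun _ hr => hr.yLow_eq hsymm i)

lemma AtSector.hasDerivAt_Fsq_charge (h : AtSector ε s A β y) (hsymm : ∀ i j, A i j = A j i) :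
    HasDerivAt (fun r => Fsq r A β y) (FsqS ε s A β y) s := by
  refine ((AtSector.hasDerivAt_Fsq (s := fun r => r) (A := fun _ => A) (β := fun _ => β)
    (y := fun _ => y) (A' := 0) (β' := 0) (y' := 0) h (hasDerivAt_id s)
    (fun _ _ => hasDerivAt_const _ _) (fun _ => hasDerivAt_const _ _)
    (fun _ => hasDerivAt_const _ _) hsymm).congr_of_eventuallyEq
    (h.eventually_charge.mono fun _ hr => hr.Fsq_eq)).congr_deriv ?_
  simp

lemma AtSector.Fsq_ne_zero (h : AtSector ε s A β y) : Fsq s A β y ≠ 0 := by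
  rw [h.Fsq_eq]
  exact mul_ne_zero h.inSector.sectorB_ne_zero h.inSector.sectorK_pos.ne'

lemma AtSector.Mbar_mul_Fsq (h : AtSector ε s A β y) (hsymm : ∀ i j, A i j = A j i) :
    Mbar s A β y * Fsq s A β y = FsqS ε s A β y := by
  rw [Mbar, div_mul_cancel₀ _ h.Fsq_ne_zero, (h.hasDerivAt_Fsq_charge hsymm).deriv]

end Fibre

/-- Contraction with `y^n y^m` makes the first two Christoffel terms equal by swapping indices. No
symmetry of `d` is needed, and both the Finslerian and the pseudo-Riemannian symbols are treated
this way. -/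
lemma christoffel_contract (U : Fin N → ℝ) (d : Fin N → Fin N → Fin N → ℝ) (y : Fin N → ℝ) :
    ∑ n, ∑ m, (1 / 2 * ∑ j, U j * (d j n m + d j m n - d n m j)) * y n * y m =
      ∑ j, U j * ((∑ n, (∑ m, y m * d j n m) * y n) -
        1 / 2 * ∑ n, y n * ∑ m, d n m j * y m) := by
  have e1 : ∀ j, ∑ n, (∑ m, y m * d j n m) * y n = ∑ n, ∑ m, d j n m * y n * y m := fun j => by
    simp only [Finset.sum_mul]
    exact Finset.sum_congr rfl fun n _ => Finset.sum_congr rfl fun m _ => by ring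
  have e2 : ∀ j, ∑ n, ∑ m, d j n m * y n * y m = ∑ n, ∑ m, d j m n * y n * y m := fun j => by
    rw [Finset.sum_comm]
    exact Finset.sum_congr rfl fun n _ => Finset.sum_congr rfl fun m _ => by ring
  have e3 : ∀ j, (∑ n, (∑ m, y m * d j n m) * y n) - 1 / 2 * ∑ n, y n * ∑ m, d n m j * y m =
      ∑ n, ∑ m, 1 / 2 * (d j n m + d j m n - d n m j) * y n * y m := fun j => by
    have : (∑ n, (∑ m, y m * d j n m) * y n) = 1 / 2 * (∑ n, ∑ m, d j n m * y n * y m) +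
        1 / 2 * ∑ n, ∑ m, d j m n * y n * y m := by
      rw [← e2, e1]; ring
    rw [this]
    simp only [Finset.mul_sum, ← Finset.sum_add_distrib, ← Finset.sum_sub_distrib]
    exact Finset.sum_congr rfl fun n _ => Finset.sum_congr rfl fun m _ => by ring
  simp only [e3]
  simp only [Finset.mul_sum, Finset.sum_mul]
  refine (Finset.sum_congr rfl fun n _ => Finset.sum_comm).trans (Finset.sum_comm.trans ?_)
  exact Finset.sum_congr rfl fun j _ => Finset.sum_congr rfl fun n _ =>
    Finset.sum_congr rfl fun m _ => by ring

/-! ### Spray coefficients in a chart -/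

namespace LocalFields

/-- The fields are symmetric and smooth at `x`. -/
structure RegularAt (L : LocalFields N) (x : Fin N → ℝ) : Prop where
  symm : ∀ z i j, L.a z i j = L.a z j i
  smooth_a : ∀ i j, ContDiffAt ℝ ∞ (fun z => L.a z i j) x
  smooth_b : ∀ i, ContDiffAt ℝ ∞ (fun z => L.b z i) x
  smooth_g : ContDiffAt ℝ ∞ L.g x

/-- The derivative of `a_ij` in the direction `w`. -/
noncomputable def aDir (L : LocalFields N) (x w : Fin N → ℝ) : Matrix (Fin N) (Fin N) ℝ :=
  Matrix.of fun i j => fderiv ℝ (fun z => L.a z i j) x w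

/-- The derivative of `b_i` in the direction `w`. -/
noncomputable def bDir (L : LocalFields N) (x w : Fin N → ℝ) (i : Fin N) : ℝ :=
  fderiv ℝ (fun z => L.b z i) x w

variable {L : LocalFields N} {x y : Fin N → ℝ} {ε : ℝ}

lemma RegularAt.eventually (hL : L.RegularAt x) (h : AtSector ε (L.g x) (L.a x) (L.b x) y) :
    ∀ᶠ z in nhds x, AtSector ε (L.g z) (L.a z) (L.b z) y :=
  AtSector.eventually (y := fun _ => y) hL.smooth_g hL.smooth_a hL.smooth_b
    (fun _ => contDiffAt_const) h

lemma RegularAt.fderiv_yExpl (hL : L.RegularAt x)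
    (h : AtSector ε (L.g x) (L.a x) (L.b x) y) (w : Fin N → ℝ) (i : Fin N) :
    fderiv ℝ (fun z => yExpl ε (L.g z) (L.a z) (L.b z) y i) x w =
      yDot ε (L.g x) (L.a x) (L.b x) y (fderiv ℝ L.g x w) (L.aDir x w) (L.bDir x w) 0 i := by
  have hcd := (AtSector.contDiffAt_yExpl (y := fun _ => y) hL.smooth_g hL.smooth_a hL.smooth_b
    (fun _ => contDiffAt_const) h i).differentiableAt (by simp)
  have hd := AtSector.hasDerivAt_yExpl (ε := ε) (t := 0) (s := fun r => L.g (x + r • w))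
    (A := fun r => L.a (x + r • w)) (β := fun r => L.b (x + r • w)) (y := fun _ => y)
    (A' := L.aDir x w) (β' := L.bDir x w) (y' := 0)
    (by simpa using h) (hasDerivAt_line w (hL.smooth_g.differentiableAt (by simp)))
    (fun i j => hasDerivAt_line w ((hL.smooth_a i j).differentiableAt (by simp)))
    (fun i => hasDerivAt_line w ((hL.smooth_b i).differentiableAt (by simp)))
    (fun _ => hasDerivAt_const _ _) (hL.symm _) i
  simpa only [zero_smul, add_zero] using fderiv_apply_eq_of_curve hcd hd

lemma RegularAt.fderiv_Fsq (hL : L.RegularAt x)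
    (h : AtSector ε (L.g x) (L.a x) (L.b x) y) (w : Fin N → ℝ) :
    fderiv ℝ (fun z => sectorB ε (L.g z) (bForm (L.b z) y) (qForm (L.a z) (L.b z) y) *
        sectorK ε (L.g z) (bForm (L.b z) y) (qForm (L.a z) (L.b z) y)) x w =
      FsqS ε (L.g x) (L.a x) (L.b x) y * fderiv ℝ L.g x w +
        sectorK ε (L.g x) (bForm (L.b x) y) (qForm (L.a x) (L.b x) y) *
          (y ⬝ᵥ L.aDir x w *ᵥ y -
            2 * L.g x * qForm (L.a x) (L.b x) y * (L.bDir x w ⬝ᵥ y)) := by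
  have hcd := ((AtSector.contDiffAt_sectorB (y := fun _ => y) hL.smooth_g hL.smooth_a hL.smooth_b
    (fun _ => contDiffAt_const) h).mul (AtSector.contDiffAt_sectorK (y := fun _ => y) hL.smooth_g
      hL.smooth_a hL.smooth_b (fun _ => contDiffAt_const) h)).differentiableAt (by simp)
  have hd := AtSector.hasDerivAt_Fsq (ε := ε) (t := 0) (s := fun r => L.g (x + r • w))
    (A := fun r => L.a (x + r • w)) (β := fun r => L.b (x + r • w)) (y := fun _ => y)
    (A' := L.aDir x w) (β' := L.bDir x w) (y' := 0)
    (by simpa using h) (hasDerivAt_line w (hL.smooth_g.differentiableAt (by simp)))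
    (fun i j => hasDerivAt_line w ((hL.smooth_a i j).differentiableAt (by simp)))
    (fun i => hasDerivAt_line w ((hL.smooth_b i).differentiableAt (by simp)))
    (fun _ => hasDerivAt_const _ _) (hL.symm _)
  simpa only [zero_smul, add_zero, Matrix.mulVec_zero, dotProduct_zero, mul_zero] using
    fderiv_apply_eq_of_curve hcd hd

/-- As `y` is constant under `∂/∂x`, the contractions with `y` can be moved inside: `y^n ∂_m g_jn =
∂_m y_j` and `y^n y^m ∂_j g_nm = ∂_j F²`. The explicit forms can be differentiated because the
sector condition is open in `x`. -/
lemma RegularAt.spray_eq (hL : L.RegularAt x)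
    (h : AtSector ε (L.g x) (L.a x) (L.b x) y) (i : Fin N) :
    L.spray x y i = ∑ j, L.metricUp x y i j *
      (fderiv ℝ (fun z => yExpl ε (L.g z) (L.a z) (L.b z) y j) x y - 1 / 2 *
        fderiv ℝ (fun z => sectorB ε (L.g z) (bForm (L.b z) y) (qForm (L.a z) (L.b z) y) *
        sectorK ε (L.g z) (bForm (L.b z) y) (qForm (L.a z) (L.b z) y)) x (Pi.single j 1)) := by
  have hev := hL.eventually h
  have hm : ∀ i j, (fun z => L.metricLow z y i j) =ᶠ[nhds x]
      fun z => metricExpl ε (L.g z) (L.a z) (L.b z) y i j := fun i j =>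
    hev.mono fun z hz => by
      change PseudoFinsleroid.metricLow _ _ _ _ i j = _
      rw [hz.metricLow_eq (hL.symm z)]
  have hdiff : ∀ i j, DifferentiableAt ℝ (fun z => L.metricLow z y i j) x := fun i j =>
    ((AtSector.contDiffAt_metricExpl (y := fun _ => y) hL.smooth_g hL.smooth_a hL.smooth_b
      (fun _ => contDiffAt_const) h i j).congr_of_eventuallyEq (hm i j)).differentiableAt (by simp)
  have hy : ∀ j, (fun z => yExpl ε (L.g z) (L.a z) (L.b z) y j) =ᶠ[nhds x]
      fun z => ∑ n, L.metricLow z y j n * y n := fun j =>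
    hev.mono fun z hz => by
      have := hz.metricExpl_mulVec_self (hL.symm z) j
      rw [← hz.metricLow_eq (hL.symm z)] at this
      exact this.symm
  have hF : (fun z => sectorB ε (L.g z) (bForm (L.b z) y) (qForm (L.a z) (L.b z) y) *
        sectorK ε (L.g z) (bForm (L.b z) y) (qForm (L.a z) (L.b z) y)) =ᶠ[nhds x]
      fun z => ∑ n, y n * ∑ m, L.metricLow z y n m * y m :=
    hev.mono fun z hz => by
      dsimp only
      rw [← hz.dotProduct_yExpl]
      refine Finset.sum_congr rfl fun n _ => ?_
      rw [← hz.metricExpl_mulVec_self (hL.symm z) n, ← hz.metricLow_eq (hL.symm z)]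
      rfl
  have h1 : ∀ j, HasFDerivAt (fun z => ∑ n, L.metricLow z y j n * y n)
      (∑ n, y n • fderiv ℝ (fun z => L.metricLow z y j n) x) x := fun j =>
    HasFDerivAt.fun_sum fun n _ => (hdiff j n).hasFDerivAt.mul_const (y n)
  have h2 : HasFDerivAt (fun z => ∑ n, y n * ∑ m, L.metricLow z y n m * y m)
      (∑ n, y n • ∑ m, y m • fderiv ℝ (fun z => L.metricLow z y n m) x) x :=
    HasFDerivAt.fun_sum fun n _ => (h1 n).const_mul (y n)
  unfold spray finslerChristoffel
  rw [christoffel_contract (L.metricUp x y i)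
    (fun j n m => pd m (fun z => L.metricLow z y j n) x) y]
  refine Finset.sum_congr rfl fun j _ => ?_
  rw [(hy j).fderiv_eq, hF.fderiv_eq, (h1 j).fderiv, h2.fderiv]
  simp only [sum_mul_pd, sum_apply, smul_apply, smul_eq_mul]
  simp only [pd, mul_comm]

lemma RegularAt.christoffel_symm (hL : L.RegularAt x) (k i j : Fin N) :
    L.christoffel x k i j = L.christoffel x k j i := by
  unfold christoffel
  congr 1
  refine Finset.sum_congr rfl fun n _ => ?_
  simp only [hL.symm _ j i]
  ring

lemma RegularAt.curl_eq (hL : L.RegularAt x) (m n : Fin N) :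
    L.curl x m n = pd m (fun z => L.b z n) x - pd n (fun z => L.b z m) x := by
  unfold curl nablaB
  simp only [hL.christoffel_symm _ m n]
  ring

lemma RegularAt.baseSpray_eq (hL : L.RegularAt x) :
    L.baseSpray x y = (L.a x)⁻¹ *ᵥ (L.aDir x y *ᵥ y -
      (1 / 2 : ℝ) • fun l => y ⬝ᵥ L.aDir x (Pi.single l 1) *ᵥ y) := by
  ext i
  unfold baseSpray christoffel
  refine (Finset.sum_congr rfl fun n _ => Finset.sum_congr rfl fun m _ => ?_).trans
    ((christoffel_contract ((L.a x)⁻¹ i) (fun j n m => pd m (fun z => L.a z j n) x) y).trans ?_)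
  · simp only [hL.symm _ m n]
  · simp only [sum_mul_pd]
    rfl

lemma fLow_eq (hL : L.RegularAt x) :
    L.fLow x y = (fun l => L.bDir x (Pi.single l 1) ⬝ᵥ y) - L.bDir x y := by
  ext k
  simp only [fLow, hL.curl_eq, sub_mul, Finset.sum_sub_distrib, Pi.sub_apply]
  congr 1
  rw [bDir, ← sum_mul_pd]
  exact Finset.sum_congr rfl fun n _ => mul_comm _ _

lemma fUp_eq : L.fUp x y = (L.a x)⁻¹ *ᵥ L.fLow x y := by
  ext i
  simp only [fUp, fLow, Matrix.mulVec, dotProduct, Finset.mul_sum, Finset.sum_mul]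
  rw [Finset.sum_comm]
  exact Finset.sum_congr rfl fun n _ => Finset.sum_congr rfl fun m _ => by ring

lemma sum_nablaB_eq :
    ∑ j, ∑ h, y j * y h * L.nablaB x j h = y ⬝ᵥ L.bDir x y - L.b x ⬝ᵥ L.baseSpray x y := by
  have e1 : y ⬝ᵥ L.bDir x y = ∑ j, ∑ h, y j * y h * pd j (fun z => L.b z h) x := by
    simp only [dotProduct, bDir, ← sum_mul_pd, Finset.mul_sum]
    rw [Finset.sum_comm]
    exact Finset.sum_congr rfl fun n _ => Finset.sum_congr rfl fun m _ => by ring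
  have e2 : L.b x ⬝ᵥ L.baseSpray x y =
      ∑ j, ∑ h, y j * y h * ∑ k, L.b x k * L.christoffel x k j h := by
    simp only [dotProduct, baseSpray, Finset.mul_sum]
    rw [Finset.sum_comm]
    refine Finset.sum_congr rfl fun n _ => ?_
    rw [Finset.sum_comm]
    exact Finset.sum_congr rfl fun n _ => Finset.sum_congr rfl fun m _ => by ring
  rw [e1, e2]
  simp only [nablaB, mul_sub, Finset.sum_sub_distrib]

/-- Puts `E^i` in the form `g^ij (…)_j`, matching the `∂g` part of the chain rule in `spray_eq`, so
the two can be compared under one sum. -/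
lemma RegularAt.ETerm_eq (hL : L.RegularAt x) (h : AtSector ε (L.g x) (L.a x) (L.b x) y)
    (i : Fin N) :
    L.ETerm x y i = ∑ j, L.metricUp x y i j *
      (yDot ε (L.g x) (L.a x) (L.b x) y 1 0 0 0 j * fderiv ℝ L.g x y -
        1 / 2 * (FsqS ε (L.g x) (L.a x) (L.b x) y * fderiv ℝ L.g x (Pi.single j 1))) := by
  have hM : Mbar (L.g x) (L.a x) (L.b x) y * L.Fsq x y = _ := h.Mbar_mul_Fsq (hL.symm x)
  have hy : ∑ h, y h * L.gradG x h = fderiv ℝ L.g x y := sum_mul_pd _ _ _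
  rw [ETerm, mul_assoc (1 / 2), hM, hy]
  simp only [(h.hasDerivAt_yLow_charge (hL.symm x) _).deriv, Finset.sum_mul, Finset.mul_sum,
    ← Finset.sum_sub_distrib]
  refine Finset.sum_congr rfl fun j _ => ?_
  rw [gradG, pd]
  ring

lemma RegularAt.spray_formula (hL : L.RegularAt x) (h : AtSector ε (L.g x) (L.a x) (L.b x) y)
    (hA : IsUnit (L.a x).det) (hc : L.b x ⬝ᵥ bUp (L.a x) (L.b x) = -L.c x ^ 2)
    (hν : L.nu x y ≠ 0) (i : Fin N) :
    L.spray x y i =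
      -ε * (L.g x / L.nu x y) *
          ((∑ j, ∑ h, y j * y h * L.nablaB x j h) -
            L.g x * qForm (L.a x) (L.b x) y * ∑ j, bUp (L.a x) (L.b x) j * L.fLow x y j) *
          vUp (L.a x) (L.b x) y i
        + L.g x * qForm (L.a x) (L.b x) y * L.fUp x y i
        + L.ETerm x y i + L.baseSpray x y i := by
  have hsymm := hL.symm x
  have hM : IsUnit (metricExpl ε (L.g x) (L.a x) (L.b x) y).det :=
    h.isUnit_det_metricExpl hsymm hA hc hν
  have hU : L.metricUp x y = (metricExpl ε (L.g x) (L.a x) (L.b x) y)⁻¹ := by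
    change (PseudoFinsleroid.metricLow _ _ _ _)⁻¹ = _
    rw [h.metricLow_eq hsymm]
  have hinv : ∀ w, L.a x *ᵥ ((L.a x)⁻¹ *ᵥ w) = w := fun w => by
    rw [Matrix.mulVec_mulVec, Matrix.mul_nonsing_inv _ hA, Matrix.one_mulVec]
  have hbase := hinv (L.aDir x y *ᵥ y -
      (1 / 2 : ℝ) • fun l => y ⬝ᵥ L.aDir x (Pi.single l 1) *ᵥ y)
  rw [← hL.baseSpray_eq] at hbase
  have hf := hinv (L.fLow x y)
  rw [← fUp_eq, fLow_eq hL] at hf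
  -- Both sides are `y^l y^n y^m ∂_l a_nm`, because a directional derivative along `y` is `y^l ∂_l`.
  have hDP : (y ⬝ᵥ fun l => y ⬝ᵥ L.aDir x (Pi.single l 1) *ᵥ y) = y ⬝ᵥ L.aDir x y *ᵥ y := by
    have : ∀ n m, L.aDir x y n m = ∑ l, y l * L.aDir x (Pi.single l 1) n m := fun n m =>
      (sum_mul_pd _ _ _).symm
    simp only [dotProduct, Matrix.mulVec, this, Finset.mul_sum, Finset.sum_mul]
    rw [Finset.sum_comm]
    refine Finset.sum_congr rfl fun n _ => ?_
    rw [Finset.sum_comm]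
    exact Finset.sum_congr rfl fun m _ => Finset.sum_congr rfl fun l _ => by ring
  have hQ : (y ⬝ᵥ fun l => L.bDir x (Pi.single l 1) ⬝ᵥ y) = y ⬝ᵥ L.bDir x y := by
    have : ∀ n, L.bDir x y n = ∑ l, y l * L.bDir x (Pi.single l 1) n := fun n =>
      (sum_mul_pd _ _ _).symm
    simp only [dotProduct, this, Finset.mul_sum]
    rw [Finset.sum_comm]
    exact Finset.sum_congr rfl fun n _ => Finset.sum_congr rfl fun l _ => by ring
  have hφ : ∑ j, bUp (L.a x) (L.b x) j * L.fLow x y j = L.b x ⬝ᵥ L.fUp x y := by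
    change bUp (L.a x) (L.b x) ⬝ᵥ L.fLow x y = _
    rw [← hinv (L.fLow x y), ← fUp_eq, dotProduct_mulVec_comm_of_symm hsymm, mulVec_bUp hA,
      dotProduct_comm]
  have hcore := h.metricExpl_mulVec_spray hsymm hA hc hν hbase hf hDP hQ sum_nablaB_eq hφ
  set S := ∑ j, ∑ h, y j * y h * L.nablaB x j h
  set φ := ∑ j, bUp (L.a x) (L.b x) j * L.fLow x y j
  -- `R` is the claimed spray without `E`. Writing it as `g^ij g_jk R^k` allows a comparison of
  -- lowered components.
  set R : Fin N → ℝ := (-ε * (L.g x / PseudoFinsleroid.nu (L.g x) (L.c x) (L.a x) (L.b x) y) *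
    (S - L.g x * qForm (L.a x) (L.b x) y * φ)) • vUp (L.a x) (L.b x) y +
      (L.g x * qForm (L.a x) (L.b x) y) • L.fUp x y + L.baseSpray x y with hR
  have hRi : R i = ∑ j, L.metricUp x y i j *
      (metricExpl ε (L.g x) (L.a x) (L.b x) y *ᵥ R) j := by
    change R i = (L.metricUp x y *ᵥ (metricExpl ε (L.g x) (L.a x) (L.b x) y *ᵥ R)) i
    rw [hU, Matrix.mulVec_mulVec, Matrix.nonsing_inv_mul _ hM, Matrix.one_mulVec]
  have hsum : L.spray x y i = R i + L.ETerm x y i := by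
    rw [hL.spray_eq h, hL.ETerm_eq h, hRi, ← Finset.sum_add_distrib]
    -- For each `j`, the part of `∂_y y_j - ½ ∂_j F²` containing derivatives of the charge is the
    -- `E` summand, and the rest is `hcore`.
    refine Finset.sum_congr rfl fun j _ => ?_
    rw [hcore j, hL.fderiv_yExpl h, hL.fderiv_Fsq h]
    simp only [yDot, qDot, Matrix.zero_mulVec, Matrix.mulVec_zero, dotProduct_zero,
      zero_dotProduct, Pi.zero_apply, mul_zero, add_zero, zero_div, sub_zero,
      dotProduct_comm (L.bDir x y) y]
    ring
  rw [hsum, hR]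
  simp only [Pi.add_apply, Pi.smul_apply, smul_eq_mul]
  change _ = -ε * (L.g x / PseudoFinsleroid.nu (L.g x) (L.c x) (L.a x) (L.b x) y) * _ * _ + _ + _ + _
  ring

lemma RegularAt.contDiffAt_Fsq (hL : L.RegularAt x)
    (h : AtSector ε (L.g x) (L.a x) (L.b x) y) :
    ContDiffAt ℝ ∞ (fun p : (Fin N → ℝ) × (Fin N → ℝ) => L.Fsq p.1 p.2) (x, y) :=
  AtSector.contDiffAt_Fsq (z := (x, y))
    (s := fun p : (Fin N → ℝ) × (Fin N → ℝ) => L.g p.1) (A := fun p => L.a p.1)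
    (β := fun p => L.b p.1) (y := fun p => p.2)
    (hL.smooth_g.comp (x, y) contDiffAt_fst)
    (fun i j => (hL.smooth_a i j).comp (x, y) contDiffAt_fst)
    (fun i => (hL.smooth_b i).comp (x, y) contDiffAt_fst)
    (fun i => by fun_prop) h

lemma ETerm_eq_zero (hg : ∀ h, L.gradG x h = 0) (i : Fin N) : L.ETerm x y i = 0 := by
  simp [ETerm, hg]

end LocalFields

/-! ### From the manifold data to a chart -/

section Space

variable {M : Type*} [TopologicalSpace M] [ChartedSpace (Fin N → ℝ) M]
  {D : Space N M} {e : OpenPartialHomeomorph M (Fin N → ℝ)} {x : Fin N → ℝ}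

lemma Space.regularAt (he : e ∈ IsManifold.maximalAtlas 𝓘(ℝ, Fin N → ℝ) ∞ M)
    (hx : x ∈ e.target) : (D.inChart e).RegularAt x where
  symm _ _ _ := D.symm _ _ _
  smooth_a i j := (D.smooth_S e he i j).contDiffAt (e.open_target.mem_nhds hx)
  smooth_b i := (D.smooth_b e he i).contDiffAt (e.open_target.mem_nhds hx)
  smooth_g := (D.smooth_g e he).contDiffAt (e.open_target.mem_nhds hx)

/-- The signature condition gives `det Pᵀ · det a · det P` as a product of entries `±1`, so `det a`
cannot vanish. -/
lemma Space.isUnit_det (he : e ∈ IsManifold.maximalAtlas 𝓘(ℝ, Fin N → ℝ) ∞ M)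
    (hx : x ∈ e.target) : IsUnit ((D.inChart e).a x).det := by
  obtain ⟨P, _, hP⟩ := D.signature e he x hx
  have := congrArg Matrix.det hP
  rw [Matrix.det_mul, Matrix.det_mul, Matrix.det_diagonal] at this
  have hne : (∏ i : Fin N, if (i : ℕ) = 0 then (1 : ℝ) else -1) ≠ 0 :=
    Finset.prod_ne_zero_iff.2 fun i _ => by split_ifs <;> norm_num
  rw [← this] at hne
  exact isUnit_iff_ne_zero.2 (right_ne_zero_of_mul (left_ne_zero_of_mul hne))

lemma Space.dotProduct_bUp (he : e ∈ IsManifold.maximalAtlas 𝓘(ℝ, Fin N → ℝ) ∞ M)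
    (hx : x ∈ e.target) : (D.inChart e).b x ⬝ᵥ bUp ((D.inChart e).a x) ((D.inChart e).b x) =
      -(D.inChart e).c x ^ 2 := by
  refine Eq.trans ?_ (D.length_b e he x hx)
  simp only [dotProduct, bUp, Finset.mul_sum]
  exact Finset.sum_congr rfl fun i _ => Finset.sum_congr rfl fun j _ => by
    simp only [Space.inChart]; ring

end Space

end PseudoFinsleroid

theorem mainTheorem1 {N : ℕ} {M : Type*} [TopologicalSpace M] [ChartedSpace (Fin N → ℝ) M]
    [IsManifold 𝓘(ℝ, Fin N → ℝ) ∞ M] (D : PseudoFinsleroid.Space N M)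
    (e : OpenPartialHomeomorph M (Fin N → ℝ))
    (he : e ∈ IsManifold.maximalAtlas 𝓘(ℝ, Fin N → ℝ) ∞ M)
    (L : PseudoFinsleroid.LocalFields N) (hL : L = D.inChart e)
    (x : Fin N → ℝ) (hx : x ∈ e.target) (y : Fin N → ℝ)
    (hy : PseudoFinsleroid.TimeLike (L.g x) (L.a x) (L.b x) y ∨
      (PseudoFinsleroid.SpaceLike (L.g x) (L.a x) (L.b x) y ∧ L.nu x y ≠ 0)) :
    -- `F²` is smooth near `(x, y)` and the Finslerian metric tensor is nondegenerate at `(x, y)`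
    ContDiffAt ℝ ∞ (fun p : (Fin N → ℝ) × (Fin N → ℝ) => L.Fsq p.1 p.2) (x, y) ∧
    IsUnit (L.metricLow x y).det ∧
    L.nu x y ≠ 0 ∧
    -- the explicit form of the spray coefficients
    (∀ i, L.spray x y i =
      -PseudoFinsleroid.indicator (L.a x) (L.b x) y * (L.g x / L.nu x y) *
          ((∑ j, ∑ h, y j * y h * L.nablaB x j h) -
            L.g x * PseudoFinsleroid.qForm (L.a x) (L.b x) y *
              ∑ j, PseudoFinsleroid.bUp (L.a x) (L.b x) j * L.fLow x y j) *
          PseudoFinsleroid.vUp (L.a x) (L.b x) y i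
        + L.g x * PseudoFinsleroid.qForm (L.a x) (L.b x) y * L.fUp x y i
        + L.ETerm x y i + L.baseSpray x y i) ∧
    -- the curl through partial derivatives
    (∀ m n, L.curl x m n = PseudoFinsleroid.pd m (fun z => L.b z n) x -
      PseudoFinsleroid.pd n (fun z => L.b z m) x) ∧
    -- the derivatives with respect to `g` that enter `E^i` exist, and `∂F²/∂g = M̄ F²`
    (∀ h, DifferentiableAt ℝ (fun s => PseudoFinsleroid.yLow s (L.a x) (L.b x) y h) (L.g x)) ∧
    HasDerivAt (fun s => PseudoFinsleroid.Fsq s (L.a x) (L.b x) y)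
      (PseudoFinsleroid.Mbar (L.g x) (L.a x) (L.b x) y * L.Fsq x y) (L.g x) ∧
    -- `E^i` vanishes where the gradient of `g` does
    ((∀ h, L.gradG x h = 0) → ∀ i, L.ETerm x y i = 0) ∧
    -- the Berwald case
    ((∀ j h, L.nablaB x j h = 0) → (∀ h, L.gradG x h = 0) →
      ∀ i, L.spray x y i = L.baseSpray x y i) := by
  have hreg : L.RegularAt x := hL ▸ PseudoFinsleroid.Space.regularAt he hx
  have hA : IsUnit (L.a x).det := hL ▸ PseudoFinsleroid.Space.isUnit_det he hx
  have hc : L.b x ⬝ᵥ PseudoFinsleroid.bUp (L.a x) (L.b x) = -L.c x ^ 2 :=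
    hL ▸ PseudoFinsleroid.Space.dotProduct_bUp he hx
  have hc0 : 0 < L.c x := hL ▸ D.c_pos (e.symm x)
  have hc1 : L.c x ≤ 1 := hL ▸ D.c_le_one (e.symm x)
  obtain ⟨ε, h, hν⟩ : ∃ ε, PseudoFinsleroid.AtSector ε (L.g x) (L.a x) (L.b x) y ∧
      L.nu x y ≠ 0 := by
    rcases hy with hy | ⟨hy, hν⟩
    · exact ⟨1, Or.inl ⟨rfl, hy⟩, (hy.nu_pos hc0 hc1).ne'⟩
    · exact ⟨-1, Or.inr ⟨rfl, hy⟩, hν⟩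
  have hspray := hreg.spray_formula h hA hc hν
  refine ⟨hreg.contDiffAt_Fsq h, ?_, hν, ?_, hreg.curl_eq, fun k =>
    (h.hasDerivAt_yLow_charge (hreg.symm x) k).differentiableAt, ?_, fun hg =>
    PseudoFinsleroid.LocalFields.ETerm_eq_zero hg, fun hn hg i => ?_⟩
  · change IsUnit (PseudoFinsleroid.metricLow _ _ _ _).det
    rw [h.metricLow_eq (hreg.symm x)]
    exact h.isUnit_det_metricExpl (hreg.symm x) hA hc hν
  · rw [h.indicator_eq]
    exact hspray
  · exact (h.hasDerivAt_Fsq_charge (hreg.symm x)).congr_deriv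
      (h.Mbar_mul_Fsq (hreg.symm x)).symm
  -- The curl is the antisymmetrization of `∇b`, so in the Berwald case the `f` terms vanish
  -- together with the `∇b` term.
  · have hcurl : ∀ m n, L.curl x m n = 0 := fun m n => by
      rw [PseudoFinsleroid.LocalFields.curl, hn, hn, sub_zero]
    rw [hspray, PseudoFinsleroid.LocalFields.ETerm_eq_zero hg]
    simp [PseudoFinsleroid.LocalFields.fLow, PseudoFinsleroid.LocalFields.fUp, hn, hcurl]
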